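/- Let $B_1$ be the open unit ball of $\mathbb R^3$, with coordinates $x=(x_1,x_2,z)$ and spherical coordinates $(r,\varphi,\theta)$: $\varphi\in[0,\pi]$ is the polar angle ($z=r\cos\varphi$) and $\theta$ is the azimuthal angle. For a $3$-vector field $v=(v_1,v_2,v_3)$ depending only on $\varphi$, let $L[v]$ be the $0$-homogeneous, axially symmetric map $$L[v]=\big(v_1\cos2\theta,\;v_1\sin2\theta,\;v_2,\;v_3\cos\theta,\;v_3\sin\theta\big).$$ Suppose that $w=L[v]$ is a (weakly) harmonic map from $B_1$ to $\mathbb S^4$, that is, $w\in H^1(B_1;\mathbb R^5)$, $|w|=1$ a.e. in $B_1$, and $-\Delta w=|\nabla w|^2w$ in $B_1$ in the sense of distributions. Suppose also that $v_1\ge0$ and $v_3\ge0$ (almost everywhere) on $(0,\pi)$. Put $N^*=(0,0,1,0,0)$ and $J(\varphi)=\arccos\!\left(\dfrac{2\cos\varphi}{1+\cos^2\varphi}\right)$. Then one of the following holds. **Class I.** $w=N^*$ a.e. in $B_1$, or $w=-N^*$ a.e. in $B_1$. **Class II.** There is $\beta_1\in(0,\pi)$ such that on $[0,\pi]$ the field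 $v$ equals $$\text{either }\left(0,\ \frac{\cos\beta_1+\cos\varphi}{1+\cos\beta_1\cos\varphi},\ \frac{\sin\beta_1\sin\varphi}{1+\cos\beta_1\cos\varphi}\right)\text{ or }\left(0,\ \frac{\cos\beta_1-\cos\varphi}{1-\cos\beta_1\cos\varphi},\ \frac{\sin\beta_1\sin\varphi}{1-\cos\beta_1\cos\varphi}\right).$$ **Class III.** There is $\beta_2\in(0,\pi)$ such that on $[0,\pi]$ the field $v$ equals $$\text{either }\left(\frac{\sin\beta_2\sin J(\varphi)}{1+\cos\beta_2\cos J(\varphi)},\ \frac{\cos\beta_2+\cos J(\varphi)}{1+\cos\beta_2\cos J(\varphi)},\ 0\right)\text{ or }\left(\frac{\sin\beta_2\sin J(\varphi)}{1-\cos\beta_2\cos J(\varphi)},\ \frac{\cos\beta_2-\cos J(\varphi)}{1-\cos\beta_2\cos J(\varphi)},\ 0\right).$$ In Classes II and III the equality holds for almost every $\varphi\in[0,\pi]$, and for every $\varphi\in[0,\pi]$ if $v$ is the continuous representative (that is, if $v$ is continuous on $[0,\pi]$). -/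

import Mathlib

open MeasureTheory Set
open scoped ContDiff

noncomputable section

namespace AxialHarmonic

/-- Points `x = (x₁, x₂, z)` of `ℝ³`. -/
abbrev E3 : Type := EuclideanSpace ℝ (Fin 3)

/-- The target space `ℝ⁵`, which contains the unit sphere `𝕊⁴`. -/
abbrev E5 : Type := EuclideanSpace ℝ (Fin 5)

/-- The open unit ball `B₁` of `ℝ³`. -/
def B1 : Set E3 := Metric.ball 0 1

/-- The polar angle `φ ∈ [0, π]` of `x`, with `cos φ = z / r`. -/
def polarAngle (x : E3) : ℝ := Real.arccos (x 2 / ‖x‖)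

/-- The azimuthal angle `θ` of `x` (modulo `2π`), with `x₁ + i x₂ = ρ e^{iθ}`. -/
def azimuth (x : E3) : ℝ := Complex.arg ⟨x 0, x 1⟩

/-- The augment operator
`L[u] = (u₁ cos 2θ, u₁ sin 2θ, u₂, u₃ cos θ, u₃ sin θ)` on `3`-vector fields. -/
def augment (u : E3 → EuclideanSpace ℝ (Fin 3)) (x : E3) : E5 :=
  !₂[u x 0 * Real.cos (2 * azimuth x), u x 0 * Real.sin (2 * azimuth x), u x 1,
    u x 2 * Real.cos (azimuth x), u x 2 * Real.sin (azimuth x)]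

/-- The map `L[v]` for a `3`-vector field `v = v(φ)` that depends only on the polar angle;
it is `0`-homogeneous and axially symmetric. -/
def augmentPolar (v : ℝ → EuclideanSpace ℝ (Fin 3)) : E3 → E5 :=
  augment (fun x => v (polarAngle x))

/-- Smooth functions with compact support contained in `Ω`. -/
def IsTestFunction {F : Type*} [NormedAddCommGroup F] [NormedSpace ℝ F]
    (Ω : Set E3) (ζ : E3 → F) : Prop :=
  ContDiff ℝ ∞ ζ ∧ HasCompactSupport ζ ∧ tsupport ζ ⊆ Ω

/-- The classical partial derivative in the `i`-th coordinate direction. -/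
def partialDeriv {F : Type*} [NormedAddCommGroup F] [NormedSpace ℝ F]
    (i : Fin 3) (ζ : E3 → F) (x : E3) : F :=
  fderiv ℝ ζ x (EuclideanSpace.single i 1)

/-- `g` is the weak `i`-th partial derivative of `w` on `Ω`
(used for `w`, `g` in `L²(Ω)`, so that both integrals converge). -/
def HasWeakPartialDeriv (Ω : Set E3) (i : Fin 3) (w g : E3 → E5) : Prop :=
  ∀ ψ : E3 → ℝ, IsTestFunction Ω ψ →
    ∫ x in Ω, partialDeriv i ψ x • w x = - ∫ x in Ω, ψ x • g x

/-- `w ∈ H¹(Ω; 𝕊⁴)` is a (weakly) harmonic map: `-Δw = |∇w|² w` in the sense of distributions.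
Here `G i` is the weak partial derivative `∂ᵢ w`, and `|∇w|² = ∑ᵢ |∂ᵢ w|²`. -/
def IsHarmonicMap (Ω : Set E3) (w : E3 → E5) : Prop :=
  ∃ G : Fin 3 → E3 → E5,
    MemLp w 2 (volume.restrict Ω) ∧
    (∀ i, MemLp (G i) 2 (volume.restrict Ω)) ∧
    (∀ i, HasWeakPartialDeriv Ω i w (G i)) ∧
    (∀ᵐ x ∂(volume.restrict Ω), ‖w x‖ = 1) ∧
    ∀ ζ : E3 → E5, IsTestFunction Ω ζ →
      ∫ x in Ω, ∑ i, inner ℝ (G i x) (partialDeriv i ζ x) =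
        ∫ x in Ω, (∑ i, ‖G i x‖ ^ 2) * inner ℝ (w x) (ζ x)

/-- The constant vector `N* = (0, 0, 1, 0, 0)`. -/
def Nstar : E5 := !₂[0, 0, 1, 0, 0]

/-- The angle function `J(φ) = arccos (2 cos φ / (1 + cos² φ))`. -/
def J (φ : ℝ) : ℝ := Real.arccos (2 * Real.cos φ / (1 + Real.cos φ ^ 2))

/-- The first family with vanishing first component. -/
def classIIa (β φ : ℝ) : EuclideanSpace ℝ (Fin 3) :=
  !₂[0,
    (Real.cos β + Real.cos φ) / (1 + Real.cos β * Real.cos φ),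
    Real.sin β * Real.sin φ / (1 + Real.cos β * Real.cos φ)]

/-- The second family with vanishing first component. -/
def classIIb (β φ : ℝ) : EuclideanSpace ℝ (Fin 3) :=
  !₂[0,
    (Real.cos β - Real.cos φ) / (1 - Real.cos β * Real.cos φ),
    Real.sin β * Real.sin φ / (1 - Real.cos β * Real.cos φ)]

/-- The first family with vanishing third component. -/
def classIIIa (β φ : ℝ) : EuclideanSpace ℝ (Fin 3) :=
  !₂[Real.sin β * Real.sin (J φ) / (1 + Real.cos β * Real.cos (J φ)),
    (Real.cos β + Real.cos (J φ)) / (1 + Real.cos β * Real.cos (J φ)),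
    0]

/-- The second family with vanishing third component. -/
def classIIIb (β φ : ℝ) : EuclideanSpace ℝ (Fin 3) :=
  !₂[Real.sin β * Real.sin (J φ) / (1 - Real.cos β * Real.cos (J φ)),
    (Real.cos β - Real.cos (J φ)) / (1 - Real.cos β * Real.cos (J φ)),
    0]

/-- `v = u` on `[0, π]`. As `H¹` maps are only defined up to null sets, this means equality almost
everywhere, and everywhere on `[0, π]` as soon as `v` is the continuous representative. -/
def AgreesOn (v u : ℝ → EuclideanSpace ℝ (Fin 3)) : Prop :=
  (∀ᵐ φ ∂(volume.restrict (Icc 0 Real.pi)), v φ = u φ) ∧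
    (ContinuousOn v (Icc 0 Real.pi) → ∀ φ ∈ Icc 0 Real.pi, v φ = u φ)

end AxialHarmonic

end

/-! The sphere minus its poles is conformal to a cylinder: the Mercator latitude `t` with `tanh t =
cos φ` (hence `1 / cosh t = sin φ`) is a harmonic function, and in it the angular part of the
Laplacian has constant coefficients up to a positive factor. For the profile `U` of `v` as a
function of `t ∈ ℝ`, the harmonic map equation becomes the sphere-valued system `U'' = a U - g U`
with `a = (4, 0, 1)`, the squares of the azimuthal frequencies, and an integrable multiplier `g`.

To derive this from the weak equation (`exists_weak_system`), one tests with products of a radial, a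
latitudinal and an angular factor supported away from the axis. Neither regularity of `v` nor a
formula for its gradient is needed: the energy density enters only through its pushforward to the
latitude, which is absolutely continuous. One-dimensional regularity (`exists_classical_solution`)
then gives a twice differentiable solution on the whole line, and the constraint `|U| = 1`
identifies `g` with `E = |U'|² + ∑ aₖ Uₖ²`, so `E` is integrable.

The classification (`classification`) rests on finite energy twice. The Hamiltonian `|U'|² - ∑ aₖ
Uₖ²` is constant and dominated by `E`, so it vanishes. The angular momentum `U₀ U₂' - U₂ U₀'` has
derivative `-3 U₀ U₂ ≤ 0` by the sign assumption and is also dominated by `E`; a monotone integrable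
function on the line is zero, so `U₀ U₂ = 0`. Since a nonnegative solution of a linear second order
equation is identically zero or positive everywhere (`eq_zero_or_pos_of_nonneg`), one of `U₀`, `U₂`
vanishes identically.

If both vanish, the map is constant. Otherwise the solution moves on a half circle, where zero
Hamiltonian reduces the system to `y' = ∓κ (1 - y²)` with `κ = 1` or `2` (`exists_kink_of_planar`,
`eq_kink`). Its solutions are Möbius transforms of `tanh (κ t)`. For `κ = 1` this is `cos φ`; for `κ
= 2` the double angle formula for `tanh` makes it `cos (J φ)`. -/

noncomputable section

namespace AxialHarmonic

/-! ### Spherical coordinates with the Mercator latitude -/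

/-- Spherical coordinates `(r, t, θ)` on `Fin 3 → ℝ`, where `tanh t` is the cosine of the polar
angle. -/
def mercatorPi (p : Fin 3 → ℝ) : Fin 3 → ℝ :=
  ![p 0 * (Real.cosh (p 1))⁻¹ * Real.cos (p 2), p 0 * (Real.cosh (p 1))⁻¹ * Real.sin (p 2),
    p 0 * Real.tanh (p 1)]

def mercatorMatrix (p : Fin 3 → ℝ) : Matrix (Fin 3) (Fin 3) ℝ :=
  !![(Real.cosh (p 1))⁻¹ * Real.cos (p 2),
      p 0 * (-Real.sinh (p 1) / Real.cosh (p 1) ^ 2) * Real.cos (p 2),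
      -(p 0 * (Real.cosh (p 1))⁻¹ * Real.sin (p 2));
    (Real.cosh (p 1))⁻¹ * Real.sin (p 2),
      p 0 * (-Real.sinh (p 1) / Real.cosh (p 1) ^ 2) * Real.sin (p 2),
      p 0 * (Real.cosh (p 1))⁻¹ * Real.cos (p 2);
    Real.tanh (p 1), p 0 * (Real.cosh (p 1) ^ 2)⁻¹, 0]

lemma hasDerivAt_tanh (t : ℝ) : HasDerivAt Real.tanh (Real.cosh t ^ 2)⁻¹ t := by
  have h := (Real.hasDerivAt_sinh t).div (Real.hasDerivAt_cosh t) (Real.cosh_pos t).ne'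
  have e : Real.tanh = fun y => Real.sinh y / Real.cosh y := by
    funext y; exact Real.tanh_eq_sinh_div_cosh y
  rw [e]
  refine h.congr_deriv ?_
  have := Real.cosh_sq t
  have hc := (Real.cosh_pos t).ne'
  field_simp
  linarith

lemma hasDerivAt_cosh_inv (t : ℝ) :
    HasDerivAt (fun s => (Real.cosh s)⁻¹) (-Real.sinh t / Real.cosh t ^ 2) t :=
  (Real.hasDerivAt_cosh t).inv (Real.cosh_pos t).ne'

lemma hasFDerivAt_mercatorPi (p : Fin 3 → ℝ) :
    HasFDerivAt mercatorPi (LinearMap.toContinuousLinearMap (Matrix.toLin' (mercatorMatrix p)))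
      p := by
  have h0 : HasFDerivAt (fun q : Fin 3 → ℝ => q 0) (ContinuousLinearMap.proj (R := ℝ) 0) p :=
    hasFDerivAt_apply 0 p
  have h1 : HasFDerivAt (fun q : Fin 3 → ℝ => q 1) (ContinuousLinearMap.proj (R := ℝ) 1) p :=
    hasFDerivAt_apply 1 p
  have h2 : HasFDerivAt (fun q : Fin 3 → ℝ => q 2) (ContinuousLinearMap.proj (R := ℝ) 2) p :=
    hasFDerivAt_apply 2 p
  have hs := (hasDerivAt_cosh_inv (p 1)).comp_hasFDerivAt p h1
  have ht := (hasDerivAt_tanh (p 1)).comp_hasFDerivAt p h1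
  have hcos := (Real.hasDerivAt_cos (p 2)).comp_hasFDerivAt p h2
  have hsin := (Real.hasDerivAt_sin (p 2)).comp_hasFDerivAt p h2
  rw [hasFDerivAt_pi']
  intro i
  fin_cases i
  · refine ((h0.mul hs).mul hcos).congr_fderiv ?_
    ext v
    simp [mercatorMatrix, Matrix.toLin'_apply, dotProduct, Fin.sum_univ_three]
    ring
  · refine ((h0.mul hs).mul hsin).congr_fderiv ?_
    ext v
    simp [mercatorMatrix, Matrix.toLin'_apply, dotProduct, Fin.sum_univ_three]
    ring
  · refine (h0.mul ht).congr_fderiv ?_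
    ext v
    simp [mercatorMatrix, Matrix.toLin'_apply, dotProduct, Fin.sum_univ_three]
    ring

lemma det_mercatorMatrix (p : Fin 3 → ℝ) :
    (mercatorMatrix p).det = -(p 0 ^ 2 * (Real.cosh (p 1) ^ 2)⁻¹) := by
  have h1 := Real.cosh_sq (p 1)
  have h2 := Real.sin_sq_add_cos_sq (p 2)
  have hc := (Real.cosh_pos (p 1)).ne'
  rw [Matrix.det_fin_three]
  simp only [mercatorMatrix, Matrix.of_apply, Matrix.cons_val', Matrix.cons_val_zero,
    Matrix.cons_val_one, Matrix.cons_val_fin_one, Matrix.cons_val,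
    Real.tanh_eq_sinh_div_cosh]
  have h3 : Real.sinh (p 1) ^ 2 = Real.cosh (p 1) ^ 2 - 1 := by linarith
  have h4 : Real.sin (p 2) ^ 2 = 1 - Real.cos (p 2) ^ 2 := by linarith
  field_simp
  ring_nf
  rw [h3, h4]
  ring

/-- The azimuth is cut at `±π`, the branch cut of `Complex.arg`, and the latitude is unrestricted.
-/
def mercatorDomain : Set (Fin 3 → ℝ) := {p | 0 < p 0 ∧ p 2 ∈ Ioo (-Real.pi) Real.pi}

lemma measurableSet_mercatorDomain : MeasurableSet mercatorDomain :=
  (measurableSet_lt measurable_const (measurable_pi_apply 0)).inter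
    ((measurable_pi_apply 2) measurableSet_Ioo)

/-- The cylindrical radius. -/
def rho (x : E3) : ℝ := √(x 0 ^ 2 + x 1 ^ 2)

/-- The Mercator latitude. -/
def lat (x : E3) : ℝ := Real.arsinh (x 2 / rho x)

lemma rho_mercatorPi {p : Fin 3 → ℝ} (hp : 0 ≤ p 0) :
    rho (WithLp.toLp 2 (mercatorPi p)) = p 0 * (Real.cosh (p 1))⁻¹ := by
  have h : mercatorPi p 0 ^ 2 + mercatorPi p 1 ^ 2 = (p 0 * (Real.cosh (p 1))⁻¹) ^ 2 := by
    simp only [mercatorPi, Matrix.cons_val_zero, Matrix.cons_val_one]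
    linear_combination (p 0 * (Real.cosh (p 1))⁻¹) ^ 2 * Real.sin_sq_add_cos_sq (p 2)
  rw [rho]
  simp only
  rw [h, Real.sqrt_sq]
  have := Real.cosh_pos (p 1)
  positivity

lemma lat_mercatorPi {p : Fin 3 → ℝ} (hp : 0 < p 0) : lat (WithLp.toLp 2 (mercatorPi p)) = p 1 := by
  have hc := (Real.cosh_pos (p 1)).ne'
  rw [lat, rho_mercatorPi hp.le]
  have : mercatorPi p 2 / (p 0 * (Real.cosh (p 1))⁻¹) = Real.sinh (p 1) := by
    simp only [mercatorPi, Matrix.cons_val, Real.tanh_eq_sinh_div_cosh]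
    field_simp
  simp only
  rw [this, Real.arsinh_sinh]

lemma arg_mercatorPi {p : Fin 3 → ℝ} (hp : p ∈ mercatorDomain) :
    Complex.arg ⟨mercatorPi p 0, mercatorPi p 1⟩ = p 2 := by
  have hc := Real.cosh_pos (p 1)
  have := Complex.arg_mul_cos_add_sin_mul_I (r := p 0 * (Real.cosh (p 1))⁻¹) (θ := p 2)
    (by have := hp.1; positivity) ⟨hp.2.1, hp.2.2.le⟩
  rw [← this]
  congr 1
  simp only [mercatorPi, Matrix.cons_val_zero, Matrix.cons_val_one]
  generalize p 0 * (Real.cosh (p 1))⁻¹ = a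
  apply Complex.ext <;> simp [← Complex.ofReal_cos, ← Complex.ofReal_sin]

/-- The latitude and the azimuth are read off by `lat` and `Complex.arg`; the cylindrical radius
then determines `r`. -/
lemma injOn_mercatorPi : InjOn mercatorPi mercatorDomain := by
  intro p hp q hq h
  have h1 : p 1 = q 1 := by rw [← lat_mercatorPi hp.1, ← lat_mercatorPi hq.1, h]
  have h2 : p 2 = q 2 := by rw [← arg_mercatorPi hp, ← arg_mercatorPi hq, h]
  have h0 : p 0 = q 0 := by
    have := rho_mercatorPi hp.1.le
    rw [h, rho_mercatorPi hq.1.le, h1] at this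
    have hc := (Real.cosh_pos (q 1)).ne'
    field_simp at this
    exact this.symm
  funext i
  fin_cases i
  exacts [h0, h1, h2]

/-- Excluding a whole plane, not just the half plane of the branch cut and the axis, loses only a
null set and makes that set a linear subspace. -/
lemma mercatorPi_surj {x : Fin 3 → ℝ} (hx : x 1 ≠ 0) : x ∈ mercatorPi '' mercatorDomain := by
  have hq : 0 < x 0 ^ 2 + x 1 ^ 2 := by positivity
  have hrho : 0 < rho (WithLp.toLp 2 x) := Real.sqrt_pos.2 hq
  have hnorm : ‖(⟨x 0, x 1⟩ : ℂ)‖ = rho (WithLp.toLp 2 x) := by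
    rw [Complex.norm_def, Complex.normSq_mk, rho]; ring_nf
  have hne : (⟨x 0, x 1⟩ : ℂ) ≠ 0 := by
    intro h; apply hx; simpa using congrArg Complex.im h
  have hch := Real.cosh_pos (lat (WithLp.toLp 2 x))
  refine ⟨![rho (WithLp.toLp 2 x) * Real.cosh (lat (WithLp.toLp 2 x)), lat (WithLp.toLp 2 x),
    Complex.arg ⟨x 0, x 1⟩], ⟨?_, ?_⟩, ?_⟩
  · simp only [Matrix.cons_val_zero]; positivity
  · simp only [Matrix.cons_val]
    refine ⟨Complex.neg_pi_lt_arg _, ?_⟩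
    rw [Complex.arg_lt_pi_iff]
    exact Or.inr hx
  · funext i
    fin_cases i
    · simp [mercatorPi, Complex.cos_arg hne, hnorm, hch.ne']
      field_simp
    · simp [mercatorPi, Complex.sin_arg, hnorm, hch.ne']
      field_simp
    · simp only [mercatorPi, Real.tanh_eq_sinh_div_cosh]
      simp [lat, Real.sinh_arsinh]
      field_simp

lemma ae_mem_image_mercatorPi :
    mercatorPi '' mercatorDomain =ᵐ[volume] (univ : Set (Fin 3 → ℝ)) := by
  rw [ae_eq_univ]
  have hsub : (mercatorPi '' mercatorDomain)ᶜ ⊆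
      (LinearMap.ker (LinearMap.proj (R := ℝ) (φ := fun _ : Fin 3 => ℝ) 1) : Set (Fin 3 → ℝ)) := by
    intro x hx
    by_contra h
    exact hx (mercatorPi_surj (by simpa using h))
  refine measure_mono_null hsub (Measure.addHaar_submodule _ _ ?_)
  rw [Ne, LinearMap.ker_eq_top]
  intro h
  have : (LinearMap.proj (R := ℝ) (φ := fun _ : Fin 3 => ℝ) 1) (fun _ => 1) = 0 := by rw [h]; rfl
  simp at this

lemma map_mercatorPi :
    Measure.map mercatorPi ((volume.restrict mercatorDomain).withDensity
      fun p => ENNReal.ofReal (p 0 ^ 2 * (Real.cosh (p 1) ^ 2)⁻¹)) = volume := by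
  have h := map_withDensity_abs_det_fderiv_eq_addHaar (volume : Measure (Fin 3 → ℝ))
    measurableSet_mercatorDomain.nullMeasurableSet
    (fun p _ => (hasFDerivAt_mercatorPi p).hasFDerivWithinAt) injOn_mercatorPi
  rw [Measure.restrict_congr_set ae_mem_image_mercatorPi, Measure.restrict_univ] at h
  refine Eq.trans ?_ h
  congr 2
  funext p
  rw [LinearMap.det_toContinuousLinearMap, LinearMap.det_toLin', det_mercatorMatrix, abs_neg,
    abs_of_nonneg (by positivity)]

/-! ### Lebesgue measure as a product measure in the Mercator coordinates. -/

/-- The measure `r² dr` on `(0, ∞)`. -/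
def radialMeasure : Measure ℝ :=
  (volume.restrict (Ioi 0)).withDensity fun r => ENNReal.ofReal (r ^ 2)

/-- The measure `cosh⁻² t dt`. -/
def latMeasure : Measure ℝ := volume.withDensity fun t => ENNReal.ofReal ((Real.cosh t ^ 2)⁻¹)

def mercatorMeasure : Measure (ℝ × ℝ × ℝ) :=
  radialMeasure.prod (latMeasure.prod (volume.restrict (Ioo (-Real.pi) Real.pi)))

instance : SFinite radialMeasure := by unfold radialMeasure; infer_instance
instance : SFinite latMeasure := by unfold latMeasure; infer_instance

/-- `(r, t, θ) ↦ x`. -/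
def mercator (p : ℝ × ℝ × ℝ) : E3 := WithLp.toLp 2 (mercatorPi ![p.1, p.2.1, p.2.2])

lemma measurePreserving_vec3 :
    MeasurePreserving (fun p : ℝ × ℝ × ℝ => (![p.1, p.2.1, p.2.2] : Fin 3 → ℝ)) volume volume := by
  have h1 := (volume_preserving_piFinSuccAbove (fun _ : Fin 3 => ℝ) 0).symm
  have h2 := (volume_preserving_finTwoArrow ℝ).symm
  have h3 : MeasurePreserving (Prod.map (id : ℝ → ℝ) (MeasurableEquiv.finTwoArrow (α := ℝ)).symm)
    volume volume := (MeasurePreserving.id (volume : Measure ℝ)).prod h2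
  convert! h1.comp h3 using 1
  funext p i
  fin_cases i <;> rfl

lemma mercatorMeasure_eq : mercatorMeasure =
    (volume.restrict (Ioi 0 ×ˢ (univ ×ˢ Ioo (-Real.pi) Real.pi))).withDensity
      fun p => ENNReal.ofReal (p.1 ^ 2 * (Real.cosh p.2.1 ^ 2)⁻¹) := by
  have m1 : Measurable fun t : ℝ => ENNReal.ofReal ((Real.cosh t ^ 2)⁻¹) := by fun_prop
  have m2 : Measurable fun t : ℝ => ENNReal.ofReal (t ^ 2) := by fun_prop
  have h1 : latMeasure.prod (volume.restrict (Ioo (-Real.pi) Real.pi)) =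
      (volume.restrict (univ ×ˢ Ioo (-Real.pi) Real.pi)).withDensity
        fun p : ℝ × ℝ => ENNReal.ofReal ((Real.cosh p.1 ^ 2)⁻¹) := by
    rw [latMeasure, prod_withDensity_left m1, Measure.volume_eq_prod, ← Measure.prod_restrict,
      Measure.restrict_univ]
  rw [mercatorMeasure, h1, radialMeasure, prod_withDensity m2 (by fun_prop),
    Measure.prod_restrict]
  congr 1
  funext p
  rw [← ENNReal.ofReal_mul (by positivity)]

lemma measurable_mercatorPi : Measurable mercatorPi := by
  refine Continuous.measurable ?_
  rw [continuous_iff_continuousAt]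
  exact fun p => (hasFDerivAt_mercatorPi p).continuousAt

theorem measurePreserving_mercator : MeasurePreserving mercator mercatorMeasure volume := by
  have hm := measurePreserving_vec3
  have e : MeasurableEmbedding fun p : ℝ × ℝ × ℝ => (![p.1, p.2.1, p.2.2] : Fin 3 → ℝ) := by
    refine MeasurableEquiv.measurableEmbedding
      (((MeasurableEquiv.refl ℝ).prodCongr (MeasurableEquiv.finTwoArrow (α := ℝ)).symm).trans
        (MeasurableEquiv.piFinSuccAbove (fun _ : Fin 3 => ℝ) 0).symm) |> fun h => ?_
    convert! h using 1
    funext p i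
    fin_cases i <;> rfl
  have h1 : MeasurePreserving (fun p : ℝ × ℝ × ℝ => (![p.1, p.2.1, p.2.2] : Fin 3 → ℝ))
      mercatorMeasure ((volume.restrict mercatorDomain).withDensity
        fun p => ENNReal.ofReal (p 0 ^ 2 * (Real.cosh (p 1) ^ 2)⁻¹)) := by
    refine ⟨hm.measurable, ?_⟩
    rw [mercatorMeasure_eq]
    have h2 := hm.restrict_preimage measurableSet_mercatorDomain
    have h3 : (fun p : ℝ × ℝ × ℝ => (![p.1, p.2.1, p.2.2] : Fin 3 → ℝ)) ⁻¹' mercatorDomain =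
        Ioi 0 ×ˢ (univ ×ˢ Ioo (-Real.pi) Real.pi) := by
      ext p; simp [mercatorDomain]
    rw [h3] at h2
    rw [← h2.map_eq]
    ext s hs
    rw [Measure.map_apply hm.measurable hs, withDensity_apply _ (hm.measurable hs),
      withDensity_apply _ hs, e.restrict_map, e.lintegral_map]
    simp
  have h2 : MeasurePreserving mercatorPi ((volume.restrict mercatorDomain).withDensity
        fun p => ENNReal.ofReal (p 0 ^ 2 * (Real.cosh (p 1) ^ 2)⁻¹)) volume :=
    ⟨measurable_mercatorPi, map_mercatorPi⟩
  exact (PiLp.volume_preserving_toLp (Fin 3)).comp (h2.comp h1)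

/-! ### Weak solutions of second order equations on the line -/

/-- Smooth compactly supported functions on the line. -/
def IsTest (η : ℝ → ℝ) : Prop := ContDiff ℝ ∞ η ∧ HasCompactSupport η

lemma IsTest.differentiate {η : ℝ → ℝ} (h : IsTest η) : IsTest (deriv η) :=
  ⟨(contDiff_infty_iff_deriv.1 h.1).2, h.2.deriv⟩

lemma IsTest.continuous {η : ℝ → ℝ} (h : IsTest η) : Continuous η := h.1.continuous

lemma IsTest.hasDerivAt {η : ℝ → ℝ} (h : IsTest η) (t : ℝ) : HasDerivAt η (deriv η t) t :=
  (h.1.differentiable (by simp) t).hasDerivAt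

lemma IsTest.exists_support_subset {η : ℝ → ℝ} (h : IsTest η) :
    ∃ N : ℝ, 0 < N ∧ tsupport η ⊆ Ioo (-N) N := by
  obtain ⟨R, hR⟩ := h.2.isBounded.subset_closedBall 0
  refine ⟨max R 0 + 1, by positivity, fun x hx => ?_⟩
  have := hR hx
  rw [mem_closedBall_zero_iff, Real.norm_eq_abs] at this
  have h2 := le_max_left R 0
  rw [abs_le] at this
  exact ⟨by linarith, by linarith⟩

lemma IsTest.integrable_mul {η f : ℝ → ℝ} (h : IsTest η) (hf : LocallyIntegrable f) :
    Integrable fun t => f t * η t := by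
  have := hf.integrable_smul_right_of_hasCompactSupport h.continuous h.2
  simpa [smul_eq_mul] using this

lemma intervalIntegrable_of_locallyIntegrable {f : ℝ → ℝ} (hf : LocallyIntegrable f) (a b : ℝ) :
    IntervalIntegrable f volume a b :=
  (hf.integrableOn_isCompact isCompact_uIcc).intervalIntegrable

/-- Integration by parts for absolutely continuous functions, on an interval at whose endpoints the
test function vanishes; Lebesgue differentiation recovers `f` almost everywhere. -/
lemma integral_primitive_mul_deriv {f η : ℝ → ℝ} (hf : LocallyIntegrable f) (h : IsTest η) :
    ∫ t, (∫ s in (0 : ℝ)..t, f s) * deriv η t = -∫ t, f t * η t := by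
  obtain ⟨N, hN, hs⟩ := h.exists_support_subset
  have h1 : Function.support (fun t => (∫ s in (0 : ℝ)..t, f s) * deriv η t) ⊆ Ioc (-N) N := by
    intro t ht
    have : t ∈ tsupport η := support_deriv_subset (by
      intro h0; apply ht; simp only [h0, mul_zero])
    exact Ioo_subset_Ioc_self (hs this)
  have h2 : Function.support (fun t => f t * η t) ⊆ Ioc (-N) N := by
    intro t ht
    have : t ∈ tsupport η := subset_tsupport _ (by
      intro h0; apply ht; simp only [h0, mul_zero])
    exact Ioo_subset_Ioc_self (hs this)
  rw [← intervalIntegral.integral_eq_integral_of_support_subset h1,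
    ← intervalIntegral.integral_eq_integral_of_support_subset h2]
  have hi := intervalIntegrable_of_locallyIntegrable hf (-N) N
  have hac := hi.absolutelyContinuousOnInterval_intervalIntegral (c := 0)
    (by rw [uIcc_of_le (by linarith)]; constructor <;> linarith)
  have hη : AbsolutelyContinuousOnInterval η (-N) N :=
    (h.1.of_le (by simp)).contDiffOn.absolutelyContinuousOnInterval
  rw [hac.integral_mul_deriv_eq_deriv_mul hη]
  have e1 : η N = 0 := by
    by_contra h0
    exact lt_irrefl _ (hs (subset_tsupport _ h0)).2
  have e2 : η (-N) = 0 := by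
    by_contra h0
    exact lt_irrefl _ (hs (subset_tsupport _ h0)).1
  rw [e1, e2]
  simp only [mul_zero, sub_zero, zero_sub, neg_inj]
  refine intervalIntegral.integral_congr_ae ?_
  filter_upwards [_root_.LocallyIntegrable.ae_hasDerivAt_integral hf] with x hx _
  rw [(hx 0).deriv]

lemma exists_isTest_integral_eq_one : ∃ ψ : ℝ → ℝ, IsTest ψ ∧ ∫ t, ψ t = 1 := by
  let b : ContDiffBump (0 : ℝ) := ⟨1, 2, one_pos, one_lt_two⟩
  exact ⟨b.normed volume, ⟨b.contDiff_normed, b.hasCompactSupport_normed⟩, b.integral_normed⟩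

/-- A test function of zero mean has a compactly supported primitive. -/
lemma IsTest.exists_primitive {ξ : ℝ → ℝ} (h : IsTest ξ) (h0 : ∫ t, ξ t = 0) :
    ∃ η, IsTest η ∧ deriv η = ξ := by
  obtain ⟨N, hN, hs⟩ := h.exists_support_subset
  have hd : ∀ t, HasDerivAt (fun t => ∫ s in (-N)..t, ξ s) (ξ t) t := fun t =>
    intervalIntegral.integral_hasDerivAt_right (h.continuous.intervalIntegrable _ _)
      (h.continuous.stronglyMeasurableAtFilter _ _) h.continuous.continuousAt
  have hde : deriv (fun t => ∫ s in (-N)..t, ξ s) = ξ := funext fun t => (hd t).deriv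
  have hz : ∀ s, s ∉ Ioo (-N) N → ξ s = 0 := fun s hs' => by
    by_contra h0
    exact hs' (hs (subset_tsupport _ h0))
  refine ⟨fun t => ∫ s in (-N)..t, ξ s, ⟨?_, ?_⟩, hde⟩
  · rw [contDiff_infty_iff_deriv, hde]
    exact ⟨fun t => (hd t).differentiableAt, h.1⟩
  · refine HasCompactSupport.intro (isCompact_Icc (a := -N) (b := N)) fun t ht => ?_
    rcases lt_or_ge t (-N) with h1 | h1
    · refine intervalIntegral.integral_zero_ae (Filter.Eventually.of_forall fun s hs' => hz s ?_)
      rw [uIoc_of_ge h1.le] at hs'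
      exact fun h => by linarith [h.1, hs'.2]
    · have h2 : N < t := by
        by_contra h2
        exact ht ⟨h1, not_lt.1 h2⟩
      rw [intervalIntegral.integral_eq_integral_of_support_subset, h0]
      intro s hs'
      have : s ∈ Ioo (-N) N := hs (subset_tsupport _ hs')
      exact ⟨this.1, by linarith [this.2]⟩

lemma IsTest.sub_smul {ξ ψ : ℝ → ℝ} (h : IsTest ξ) (h' : IsTest ψ) (c : ℝ) :
    IsTest (fun t => ξ t - c * ψ t) :=
  ⟨h.1.sub (contDiff_const.mul h'.1), h.2.sub (h'.2.mul_left)⟩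

/-- The du Bois-Reymond lemma. -/
lemma ae_eq_const_of_forall_integral_mul_deriv {K : ℝ → ℝ} (hK : LocallyIntegrable K)
    (h : ∀ η, IsTest η → ∫ t, K t * deriv η t = 0) : ∃ c, ∀ᵐ t, K t = c := by
  obtain ⟨ψ, hψ, h1⟩ := exists_isTest_integral_eq_one
  refine ⟨∫ t, K t * ψ t, ?_⟩
  set c := ∫ t, K t * ψ t with hc
  have hKc : LocallyIntegrable fun t => K t - c := hK.sub (locallyIntegrable_const c)
  have := ae_eq_zero_of_integral_contDiff_smul_eq_zero hKc (fun ξ hξ hξ' => ?_)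
  · filter_upwards [this] with t ht using sub_eq_zero.1 ht
  · have hT : IsTest ξ := ⟨hξ, hξ'⟩
    have i1 : Integrable ξ := hT.continuous.integrable_of_hasCompactSupport hξ'
    have i2 : Integrable ψ := hψ.continuous.integrable_of_hasCompactSupport hψ.2
    have i3 := hT.integrable_mul hK
    have i4 := hψ.integrable_mul hK
    -- Subtracting the multiple of `ψ` with the same mass makes an arbitrary test function the
    -- derivative of a test function.
    obtain ⟨η, hη, hde⟩ := (hT.sub_smul hψ (∫ t, ξ t)).exists_primitive (by
      rw [integral_sub i1 (i2.const_mul _), integral_const_mul, h1]; ring)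
    have h2 := h η hη
    rw [hde] at h2
    have h3 : ∫ t, K t * (ξ t - (∫ t, ξ t) * ψ t) = (∫ t, K t * ξ t) - (∫ t, ξ t) * c := by
      rw [hc, ← integral_const_mul, ← integral_sub i3 (i4.const_mul _)]
      congr 1; funext t; ring
    have h4 : ∫ t, ξ t • (K t - c) = (∫ t, K t * ξ t) - (∫ t, ξ t) * c := by
      rw [← integral_mul_const, ← integral_sub i3 (i1.mul_const _)]
      congr 1; funext t; rw [smul_eq_mul]; ring
    rw [h4, ← h3, h2]

lemma continuous_primitive_of_locallyIntegrable {f : ℝ → ℝ} (hf : LocallyIntegrable f) :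
    Continuous fun t => ∫ s in (0 : ℝ)..t, f s :=
  intervalIntegral.continuous_primitive (fun a b => intervalIntegrable_of_locallyIntegrable hf a b) 0

lemma ae_eq_primitive_of_weak_deriv {G f : ℝ → ℝ} (hG : LocallyIntegrable G)
    (hf : LocallyIntegrable f)
    (h : ∀ η, IsTest η → ∫ t, G t * deriv η t = -∫ t, f t * η t) :
    ∃ c, ∀ᵐ t, G t = c + ∫ s in (0 : ℝ)..t, f s := by
  have hF := (continuous_primitive_of_locallyIntegrable hf).locallyIntegrable (μ := volume)
  obtain ⟨c, hc⟩ := ae_eq_const_of_forall_integral_mul_deriv (hG.sub hF) (fun η hη => by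
    have e := integral_sub (hη.differentiate.integrable_mul hG) (hη.differentiate.integrable_mul hF)
    rw [h η hη, integral_primitive_mul_deriv hf hη, sub_self] at e
    refine Eq.trans ?_ e
    congr 1; funext t; simp only [Pi.sub_apply]; ring)
  refine ⟨c, ?_⟩
  filter_upwards [hc] with t ht
  simp only [Pi.sub_apply] at ht
  linarith

/-- A weak solution of `U'' = f` is, up to a null set, a `C¹` function with the absolutely
continuous derivative `c + ∫ f`. -/
lemma exists_hasDerivAt_of_weak_second_deriv {U f : ℝ → ℝ} (hU : LocallyIntegrable U)
    (hf : LocallyIntegrable f)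
    (h : ∀ η, IsTest η → ∫ t, U t * deriv (deriv η) t = ∫ t, f t * η t) :
    ∃ (W : ℝ → ℝ) (c : ℝ), (∀ᵐ t, U t = W t) ∧
      ∀ t, HasDerivAt W (c + ∫ s in (0 : ℝ)..t, f s) t := by
  obtain ⟨ψ, hψ, h1⟩ := exists_isTest_integral_eq_one
  set F := fun t => ∫ s in (0 : ℝ)..t, f s with hFdef
  have hFc : Continuous F := continuous_primitive_of_locallyIntegrable hf
  have hF := hFc.locallyIntegrable (μ := volume)
  -- The constant is forced by requiring that `c + F` be the weak derivative of `U` when tested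
  -- against `ψ`, whose integral is one.
  set c := -((∫ t, U t * deriv ψ t) + ∫ t, F t * ψ t) with hc
  have hcF : Continuous fun t => c + F t := by fun_prop
  have key : ∀ ξ, IsTest ξ → ∫ t, U t * deriv ξ t = -∫ t, (c + F t) * ξ t := by
    intro ξ hξ
    have i1 : Integrable ξ := hξ.continuous.integrable_of_hasCompactSupport hξ.2
    have i2 : Integrable ψ := hψ.continuous.integrable_of_hasCompactSupport hψ.2
    obtain ⟨η, hη, hde⟩ := (hξ.sub_smul hψ (∫ t, ξ t)).exists_primitive (by
      rw [integral_sub i1 (i2.const_mul _), integral_const_mul, h1]; ring)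
    have e1 := h η hη
    have e2 := integral_primitive_mul_deriv hf hη
    have hdd : deriv (fun t => ξ t - (∫ t, ξ t) * ψ t) = fun t => deriv ξ t - (∫ t, ξ t) * deriv ψ t := by
      funext t
      exact ((hξ.hasDerivAt t).sub ((hψ.hasDerivAt t).const_mul _)).deriv
    rw [hde, hdd] at e1
    rw [hde] at e2
    have e3 : ∫ t, U t * (deriv ξ t - (∫ t, ξ t) * deriv ψ t) =
        (∫ t, U t * deriv ξ t) - (∫ t, ξ t) * ∫ t, U t * deriv ψ t := by
      rw [← integral_const_mul, ← integral_sub (hξ.differentiate.integrable_mul hU)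
        ((hψ.differentiate.integrable_mul hU).const_mul _)]
      congr 1; funext t; ring
    have e4 : ∫ t, F t * (ξ t - (∫ t, ξ t) * ψ t) =
        (∫ t, F t * ξ t) - (∫ t, ξ t) * ∫ t, F t * ψ t := by
      rw [← integral_const_mul, ← integral_sub (hξ.integrable_mul hF)
        ((hψ.integrable_mul hF).const_mul _)]
      congr 1; funext t; ring
    have e5 : ∫ t, (c + F t) * ξ t = c * (∫ t, ξ t) + ∫ t, F t * ξ t := by
      rw [← integral_const_mul, ← integral_add (i1.const_mul _) (hξ.integrable_mul hF)]
      congr 1; funext t; ring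
    rw [e3] at e1
    rw [e4] at e2
    rw [e5, hc]
    linear_combination e1 + e2
  obtain ⟨d, hd⟩ := ae_eq_primitive_of_weak_deriv hU (hcF.locallyIntegrable (μ := volume)) key
  refine ⟨_, c, hd, fun t => ?_⟩
  exact (intervalIntegral.integral_hasDerivAt_right (hcF.intervalIntegrable _ _)
    (hcF.stronglyMeasurableAtFilter _ _) hcF.continuousAt).const_add d

/-! ### Regularity of sphere-valued weak solutions. -/

/-- The energy density of a curve for the quadratic potential `∑ aₖ yₖ²`. -/
def energy (a : Fin 3 → ℝ) (W W' : Fin 3 → ℝ → ℝ) (t : ℝ) : ℝ :=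
  ∑ k, W' k t ^ 2 + ∑ k, a k * W k t ^ 2

/-- Regularity of weak solutions, with values in the sphere, of `U'' = a U - g U`; the Lagrange
multiplier `g` is the energy density. -/
theorem exists_classical_solution {a : Fin 3 → ℝ} {U : Fin 3 → ℝ → ℝ} {g : ℝ → ℝ}
    (hmeas : ∀ k, AEStronglyMeasurable (U k)) (hsph : ∀ᵐ t, ∑ k, U k t ^ 2 = 1)
    (hg : Integrable g)
    (hweak : ∀ k, ∀ η, IsTest η →
      ∫ t, U k t * (deriv (deriv η) t - a k * η t) = -∫ t, g t * (U k t * η t)) :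
    ∃ W W' : Fin 3 → ℝ → ℝ, (∀ k, ∀ᵐ t, U k t = W k t) ∧ (∀ t, ∑ k, W k t ^ 2 = 1) ∧
      (∀ k t, HasDerivAt (W k) (W' k t) t) ∧
      (∀ k t, HasDerivAt (W' k) (a k * W k t - energy a W W' t * W k t) t) ∧
      Integrable (energy a W W') := by
  have hbd : ∀ k, ∀ᵐ t, ‖U k t‖ ≤ 1 := fun k => by
    filter_upwards [hsph] with t ht
    rw [Real.norm_eq_abs, ← sq_le_one_iff_abs_le_one, ← ht]
    exact Finset.single_le_sum (f := fun k => U k t ^ 2) (fun i _ => sq_nonneg _) (Finset.mem_univ k)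
  have hUloc : ∀ k, LocallyIntegrable (U k) := fun k =>
    (memLp_top_of_bound (hmeas k) 1 (hbd k)).locallyIntegrable le_top
  have hgU : ∀ k, Integrable fun t => g t * U k t := fun k =>
    (hg.bdd_mul (hmeas k) (hbd k)).congr (Filter.Eventually.of_forall fun t => mul_comm _ _)
  have hfloc : ∀ k, LocallyIntegrable fun t => a k * U k t - g t * U k t := fun k =>
    ((hUloc k).smul (a k)).sub (hgU k).locallyIntegrable
  have hex := fun k => exists_hasDerivAt_of_weak_second_deriv (hUloc k) (hfloc k) (fun η hη => by
    have i1 := hη.differentiate.differentiate.integrable_mul (hUloc k)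
    have i2 := hη.integrable_mul (hUloc k)
    have i3 := hη.integrable_mul (hgU k).locallyIntegrable
    have e1 : ∫ t, U k t * (deriv (deriv η) t - a k * η t) =
        (∫ t, U k t * deriv (deriv η) t) - a k * ∫ t, U k t * η t := by
      rw [← integral_const_mul, ← integral_sub i1 (i2.const_mul _)]
      congr 1; funext t; ring
    have e2 : ∫ t, (a k * U k t - g t * U k t) * η t =
        a k * (∫ t, U k t * η t) - ∫ t, g t * (U k t * η t) := by
      rw [← integral_const_mul]
      have i3' : Integrable fun t => g t * (U k t * η t) := by simpa only [mul_assoc] using i3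
      rw [← integral_sub (i2.const_mul _) i3']
      congr 1; funext t; ring
    linarith [hweak k η hη])
  choose W c hUW hW using hex
  set W' : Fin 3 → ℝ → ℝ := fun k t => c k + ∫ s in (0 : ℝ)..t, (a k * U k s - g s * U k s) with hW'
  have hWc : ∀ k, Continuous (W k) := fun k =>
    continuous_iff_continuousAt.2 fun t => (hW k t).continuousAt
  have hW'c : ∀ k, Continuous (W' k) := fun k =>
    continuous_const.add (continuous_primitive_of_locallyIntegrable (hfloc k))
  have hEc : Continuous (energy a W W') := by unfold energy; fun_prop
  have hsphW : ∀ t, ∑ k, W k t ^ 2 = 1 := by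
    have : (fun t => ∑ k, W k t ^ 2) =ᵐ[volume] fun _ => (1 : ℝ) := by
      filter_upwards [hsph, ae_all_iff.2 hUW] with t h1 h2
      simpa only [h2] using h1
    exact congrFun (Continuous.ae_eq_iff_eq volume (by fun_prop) continuous_const |>.1 this)
  have horth : ∀ t, ∑ k, W k t * W' k t = 0 := fun t => by
    have h1 : HasDerivAt (fun t => ∑ k, W k t ^ 2) (∑ k, 2 * (W k t * W' k t)) t :=
      HasDerivAt.fun_sum fun k _ => ((hW k t).pow 2).congr_deriv (by simp only [hW']; ring)
    have h2 : (fun t => ∑ k, W k t ^ 2) = fun _ => 1 := funext hsphW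
    rw [h2] at h1
    have := h1.unique (hasDerivAt_const t 1)
    rw [← Finset.mul_sum] at this
    linarith
  -- Differentiating `∑ Wₖ Wₖ' = 0` wherever the primitives are differentiable and inserting the
  -- equation gives `|W'|² + ∑ aₖ Wₖ² - g = 0`.
  have hgE : ∀ᵐ t, g t = energy a W W' t := by
    filter_upwards [ae_all_iff.2 hUW, ae_all_iff.2 fun k =>
        _root_.LocallyIntegrable.ae_hasDerivAt_integral (hfloc k)]
      with t h1 h2
    have h3 : HasDerivAt (fun t => ∑ k, W k t * W' k t)
        (∑ k, (W' k t * W' k t + W k t * (a k * U k t - g t * U k t))) t :=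
      HasDerivAt.fun_sum fun k _ => (hW k t).mul ((h2 k 0).const_add (c k))
    have h4 : (fun t => ∑ k, W k t * W' k t) = fun _ => 0 := funext horth
    rw [h4] at h3
    have h5 := h3.unique (hasDerivAt_const t 0)
    have h6 := hsphW t
    simp only [h1, Fin.sum_univ_three, energy] at h5 h6 ⊢
    linear_combination -h5 - g t * h6
  refine ⟨W, W', hUW, hsphW, hW, fun k t => ?_, hg.congr hgE⟩
  -- The integrand is now continuous, so the derivative of `W' k` exists at every point rather than
  -- almost everywhere.
  have e : W' k = fun t => c k + ∫ s in (0 : ℝ)..t, (a k * W k s - energy a W W' s * W k s) := by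
    funext t
    simp only [hW']
    congr 1
    refine intervalIntegral.integral_congr_ae ?_
    filter_upwards [hUW k, hgE] with s h1 h2 _
    rw [h1, h2]
  have hcont : Continuous fun s => a k * W k s - energy a W W' s * W k s := by fun_prop
  rw [e]
  exact (intervalIntegral.integral_hasDerivAt_right (hcont.intervalIntegrable _ _)
    (hcont.stronglyMeasurableAtFilter _ _) hcont.continuousAt).const_add (c k)

/-! ### Finite energy solutions of the system on the line -/

/-- The solutions of `y' = -σ κ (1 - y²)` with values in `(-1, 1)`. -/
lemma eq_kink {y p : ℝ → ℝ} {κ σ : ℝ} (hσ : σ = 1 ∨ σ = -1)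
    (hyp : ∀ t, y t ^ 2 + p t ^ 2 = 1) (hp : ∀ t, 0 < p t)
    (hy : ∀ t, HasDerivAt y (-(σ * κ * p t ^ 2)) t) :
    ∃ β ∈ Ioo 0 Real.pi, ∀ t,
      y t = (Real.cos β - σ * Real.tanh (κ * t)) / (1 - σ * (Real.cos β * Real.tanh (κ * t))) ∧
      p t = Real.sin β * (Real.cosh (κ * t))⁻¹ / (1 - σ * (Real.cos β * Real.tanh (κ * t))) := by
  have hσ2 : σ ^ 2 = 1 := by rcases hσ with h | h <;> rw [h] <;> norm_num
  have hylt : ∀ t, |y t| < 1 := fun t => by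
    rw [← sq_lt_one_iff_abs_lt_one]; nlinarith [hyp t, hp t]
  have hτlt : ∀ t, |σ * Real.tanh t| < 1 := fun t => by
    rw [abs_mul]
    have : |σ| = 1 := by rcases hσ with h | h <;> rw [h] <;> norm_num
    rw [this, one_mul]
    exact Real.abs_tanh_lt_one t
  have hpos : ∀ a b : ℝ, |a| < 1 → |b| < 1 → 0 < 1 - a * b := fun a b ha hb => by
    have : |a * b| < 1 := by
      rw [abs_mul]; exact mul_lt_one_of_nonneg_of_lt_one_left (abs_nonneg _) ha hb.le
    linarith [(abs_lt.1 this).2]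
  have hpos' : ∀ a b : ℝ, |a| < 1 → |b| < 1 → 0 < 1 + a * b := fun a b ha hb => by
    have := hpos (-a) b (by rwa [abs_neg]) hb
    linarith
  have hτ : ∀ t, HasDerivAt (fun t => σ * Real.tanh (κ * t))
      (σ * κ * (1 - (σ * Real.tanh (κ * t)) ^ 2)) t := fun t => by
    have h1 := ((hasDerivAt_tanh (κ * t)).comp t ((hasDerivAt_id t).const_mul κ)).const_mul σ
    refine h1.congr_deriv ?_
    have hc := (Real.cosh_pos (κ * t)).ne'
    have e := Real.cosh_sq (κ * t)
    rw [mul_pow, hσ2, Real.tanh_eq_sinh_div_cosh]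
    field_simp
    rw [e]; ring
  -- By the addition formula `Q` is `tanh (artanh y + σ κ t)`, a first integral of the equation;
  -- solving `Q t = Q 0` for `y t` gives the formula, with `y 0 = cos β`.
  set Q : ℝ → ℝ := fun t => (y t + σ * Real.tanh (κ * t)) / (1 + y t * (σ * Real.tanh (κ * t)))
  have hQ : ∀ t, HasDerivAt Q 0 t := fun t => by
    have hne := (hpos' _ _ (hylt t) (hτlt (κ * t))).ne'
    have h1 := ((hy t).add (hτ t)).div (((hy t).mul (hτ t)).const_add 1) hne
    refine h1.congr_deriv ?_
    have e : p t ^ 2 = 1 - y t ^ 2 := by linarith [hyp t]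
    rw [div_eq_zero_iff]
    left
    simp only [Pi.add_apply, Pi.mul_apply]
    rw [e]; ring
  have hQc : ∀ t, Q t = y 0 := fun t => by
    have := is_const_of_deriv_eq_zero (fun t => (hQ t).differentiableAt) (fun t => (hQ t).deriv) t 0
    rw [this]; simp [Q]
  have hb := abs_lt.1 (hylt 0)
  have hcos : Real.cos (Real.arccos (y 0)) = y 0 := Real.cos_arccos hb.1.le hb.2.le
  have hβ : Real.arccos (y 0) ∈ Ioo 0 Real.pi := by
    refine ⟨Real.arccos_pos.2 hb.2, lt_of_le_of_ne (Real.arccos_le_pi _) fun h => ?_⟩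
    rw [h, Real.cos_pi] at hcos
    linarith [hb.1]
  refine ⟨Real.arccos (y 0), hβ, fun t => ?_⟩
  rw [hcos]
  have hs := Real.sin_pos_of_mem_Ioo hβ
  have hs2 : Real.sin (Real.arccos (y 0)) ^ 2 = 1 - y 0 ^ 2 := by
    rw [Real.sin_sq, hcos]
  have hD : 0 < 1 - σ * (y 0 * Real.tanh (κ * t)) := by
    have := hpos _ _ (hylt 0) (hτlt (κ * t)); linarith
  have h1 : y t = (y 0 - σ * Real.tanh (κ * t)) / (1 - σ * (y 0 * Real.tanh (κ * t))) := by
    have hne := (hpos' _ _ (hylt t) (hτlt (κ * t))).ne'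
    have := hQc t
    simp only [Q] at this
    rw [div_eq_iff hne] at this
    rw [eq_div_iff hD.ne']
    linear_combination this
  refine ⟨h1, ?_⟩
  have hch := Real.cosh_pos (κ * t)
  -- Both sides are nonnegative, so it is enough to compare squares, using `p² = 1 - y²`.
  rw [← sq_eq_sq₀ (hp t).le (by positivity), div_pow, mul_pow, hs2,
    show p t ^ 2 = 1 - y t ^ 2 by linarith [hyp t], h1, div_pow, eq_div_iff (by positivity),
    sub_mul, div_mul_cancel₀ _ (by positivity), Real.tanh_eq_sinh_div_cosh]
  have e := Real.cosh_sq (κ * t)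
  have e' : Real.sinh (κ * t) ^ 2 = Real.cosh (κ * t) ^ 2 - 1 := by linarith
  field_simp
  linear_combination (y 0 ^ 2 * σ ^ 2 - σ ^ 2) * e' + (Real.cosh (κ * t) ^ 2 - 1) * (y 0 ^ 2 - 1) * hσ2

/-- Planar zero energy solutions that stay in the open half circle `p > 0`. -/
lemma exists_kink_of_planar {y p y' p' : ℝ → ℝ} {κ : ℝ} (hκ : 0 < κ)
    (hyp : ∀ t, y t ^ 2 + p t ^ 2 = 1) (hp : ∀ t, 0 < p t)
    (hy : ∀ t, HasDerivAt y (y' t) t) (hpd : ∀ t, HasDerivAt p (p' t) t)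
    (hy'c : Continuous y') (hp'c : Continuous p')
    (hH : ∀ t, y' t ^ 2 + p' t ^ 2 = κ ^ 2 * p t ^ 2) :
    ∃ σ : ℝ, (σ = 1 ∨ σ = -1) ∧ ∃ β ∈ Ioo 0 Real.pi, ∀ t,
      y t = (Real.cos β - σ * Real.tanh (κ * t)) / (1 - σ * (Real.cos β * Real.tanh (κ * t))) ∧
      p t = Real.sin β * (Real.cosh (κ * t))⁻¹ / (1 - σ * (Real.cos β * Real.tanh (κ * t))) := by
  have hyc : Continuous y := continuous_iff_continuousAt.2 fun t => (hy t).continuousAt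
  have hpc : Continuous p := continuous_iff_continuousAt.2 fun t => (hpd t).continuousAt
  have horth : ∀ t, y t * y' t + p t * p' t = 0 := fun t => by
    have h1 := ((hy t).pow 2).add ((hpd t).pow 2)
    have h2 : y ^ 2 + p ^ 2 = fun _ => 1 := funext hyp
    rw [h2] at h1
    have := h1.unique (hasDerivAt_const t 1)
    norm_num at this
    linarith [this]
  -- Lagrange's identity: on the unit circle, with the velocity orthogonal to the position, the
  -- squared angular momentum equals the squared speed. As `κ p` never vanishes, connectedness then
  -- fixes a single sign `σ`.
  have hsq : EqOn ((fun t => y t * p' t - p t * y' t) ^ 2) ((fun t => κ * p t) ^ 2) univ := by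
    intro t _
    simp only [Pi.pow_apply]
    linear_combination (p' t ^ 2 + y' t ^ 2) * hyp t + hH t -
      (y t * y' t + p t * p' t) * horth t
  have hsign := isPreconnected_univ.eq_or_eq_neg_of_sq_eq
    (by fun_prop : Continuous fun t => y t * p' t - p t * y' t).continuousOn
    (by fun_prop : Continuous fun t => κ * p t).continuousOn hsq
    (fun {t} _ => (mul_pos hκ (hp t)).ne')
  obtain ⟨σ, hσ, hl⟩ : ∃ σ : ℝ, (σ = 1 ∨ σ = -1) ∧
      ∀ t, y t * p' t - p t * y' t = σ * (κ * p t) := by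
    rcases hsign with h | h
    · exact ⟨1, Or.inl rfl, fun t => by simpa using h (mem_univ t)⟩
    · exact ⟨-1, Or.inr rfl, fun t => by simpa using h (mem_univ t)⟩
  refine ⟨σ, hσ, eq_kink hσ hyp hp fun t => (hy t).congr_deriv ?_⟩
  linear_combination -(y' t) * hyp t + y t * horth t - p t * hl t

/-- A bound on the coefficient makes the first order system uniformly Lipschitz in the state, so ODE
uniqueness compares the solution with zero. -/
lemma eq_zero_of_second_order {u u' c : ℝ → ℝ} {C : ℝ} (hu : ∀ t, HasDerivAt u (u' t) t)
    (hu' : ∀ t, HasDerivAt u' (c t * u t) t) (hc : ∀ t, |c t| ≤ C) {t₀ : ℝ} (h0 : u t₀ = 0)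
    (h1 : u' t₀ = 0) (t : ℝ) : u t = 0 := by
  have hC : 0 ≤ C := (abs_nonneg _).trans (hc 0)
  have hlip : ∀ t : ℝ, LipschitzOnWith (max 1 C).toNNReal (fun z : ℝ × ℝ => (z.2, c t * z.1)) univ := by
    intro t
    refine LipschitzOnWith.of_dist_le_mul fun z _ w _ => ?_
    simp only [Real.coe_toNNReal _ (show 0 ≤ max 1 C by positivity), Prod.dist_eq, Real.dist_eq]
    have hm1 := le_max_left (1 : ℝ) C
    have hm2 := le_max_right (1 : ℝ) C
    refine max_le ?_ ?_
    · calc |z.2 - w.2| = 1 * |z.2 - w.2| := by ring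
        _ ≤ _ := mul_le_mul hm1 (le_max_right _ _) (abs_nonneg _) (by positivity)
    · rw [← mul_sub, abs_mul]
      exact mul_le_mul ((hc t).trans hm2) (le_max_left _ _) (abs_nonneg _) (by positivity)
  have := ODE_solution_unique_univ (f := fun t => (u t, u' t)) (g := fun _ => ((0, 0) : ℝ × ℝ))
    (t₀ := t₀) hlip (fun t => ⟨(hu t).prodMk (hu' t), mem_univ _⟩)
    (fun t => ⟨by simpa using! hasDerivAt_const t ((0, 0) : ℝ × ℝ), mem_univ _⟩) (by simp [h0, h1])
  exact congrArg Prod.fst (congrFun this t)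

/-- A nonnegative solution of a linear second order equation vanishes identically or nowhere. -/
lemma eq_zero_or_pos_of_nonneg {u u' c : ℝ → ℝ} {C : ℝ} (hu : ∀ t, HasDerivAt u (u' t) t)
    (hu' : ∀ t, HasDerivAt u' (c t * u t) t) (hc : ∀ t, |c t| ≤ C) (hn : ∀ t, 0 ≤ u t) :
    (∀ t, u t = 0) ∨ ∀ t, 0 < u t := by
  by_cases h : ∃ t₀, u t₀ = 0
  · obtain ⟨t₀, h0⟩ := h
    left
    -- A zero of a nonnegative function is a minimum, so both Cauchy data vanish there.
    have hmin : IsLocalMin u t₀ := Filter.Eventually.of_forall fun t => by rw [h0]; exact hn t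
    have h1 : u' t₀ = 0 := hmin.hasDerivAt_eq_zero (hu t₀)
    exact fun t => eq_zero_of_second_order hu hu' hc h0 h1 t
  · right
    exact fun t => lt_of_le_of_ne (hn t) fun h' => h ⟨t, h'.symm⟩

lemma const_eq_zero_of_integrable {c : ℝ} (h : Integrable fun _ : ℝ => c) : c = 0 := by
  rw [integrable_const_iff] at h
  rcases h with h | h
  · exact h
  · exact absurd h (by simp [isFiniteMeasure_iff])

/-- An integrable antitone function on the line vanishes. -/
lemma eq_zero_of_antitone_of_integrable {f : ℝ → ℝ} (hf : Antitone f) (hi : Integrable f) (t : ℝ) :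
    f t = 0 := by
  by_contra h
  have hlt := hi.measure_norm_ge_lt_top (abs_pos.2 h)
  refine hlt.not_ge (top_le_iff.2 ?_).ge
  rcases lt_or_gt_of_ne h with h | h
  · refine measure_mono_top (s₁ := Ici t) (fun s hs => ?_) Real.volume_Ici
    have := hf (mem_Ici.1 hs)
    simp only [mem_ofPred_eq, Real.norm_eq_abs]
    rw [abs_of_neg h, abs_of_neg (by linarith)]
    linarith
  · refine measure_mono_top (s₁ := Iic t) (fun s hs => ?_) Real.volume_Iic
    have := hf (mem_Iic.1 hs)
    simp only [mem_ofPred_eq, Real.norm_eq_abs]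
    rw [abs_of_pos h, abs_of_pos (by linarith)]
    linarith

/-- The coefficients `4, 0, 1` of the quadratic potential. -/
def potential : Fin 3 → ℝ := ![4, 0, 1]

/-- The profile `(cos β - σ tanh s) / (1 - σ cos β tanh s)` and its companion. -/
def kink (σ β s : ℝ) : ℝ := (Real.cos β - σ * Real.tanh s) / (1 - σ * (Real.cos β * Real.tanh s))

/-- For `σ = ±1` this is the coordinate that completes `kink` to a point of the unit circle. -/
def soliton (σ β s : ℝ) : ℝ := Real.sin β * (Real.cosh s)⁻¹ / (1 - σ * (Real.cos β * Real.tanh s))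

/-- Classification of the finite energy solutions with nonnegative first and third components. -/
theorem classification {W W' : Fin 3 → ℝ → ℝ} (hsph : ∀ t, ∑ k, W k t ^ 2 = 1)
    (hW : ∀ k t, HasDerivAt (W k) (W' k t) t)
    (hW' : ∀ k t, HasDerivAt (W' k)
      (potential k * W k t - energy potential W W' t * W k t) t)
    (hE : Integrable (energy potential W W')) (h0 : ∀ t, 0 ≤ W 0 t) (h2 : ∀ t, 0 ≤ W 2 t) :
    ((∀ t, W 0 t = 0 ∧ W 1 t = 1 ∧ W 2 t = 0) ∨ (∀ t, W 0 t = 0 ∧ W 1 t = -1 ∧ W 2 t = 0)) ∨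
    (∃ σ : ℝ, (σ = 1 ∨ σ = -1) ∧ ∃ β ∈ Ioo 0 Real.pi,
      ∀ t, W 0 t = 0 ∧ W 1 t = kink σ β t ∧ W 2 t = soliton σ β t) ∨
    (∃ σ : ℝ, (σ = 1 ∨ σ = -1) ∧ ∃ β ∈ Ioo 0 Real.pi,
      ∀ t, W 0 t = soliton σ β (2 * t) ∧ W 1 t = kink σ β (2 * t) ∧ W 2 t = 0) := by
  have hWc : ∀ k, Continuous (W k) := fun k =>
    continuous_iff_continuousAt.2 fun t => (hW k t).continuousAt
  have hW'c : ∀ k, Continuous (W' k) := fun k =>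
    continuous_iff_continuousAt.2 fun t => (hW' k t).continuousAt
  set E := energy potential W W' with hEdef
  have hEe : ∀ t, E t = W' 0 t ^ 2 + W' 1 t ^ 2 + W' 2 t ^ 2 + 4 * W 0 t ^ 2 + W 2 t ^ 2 := by
    intro t
    simp only [hEdef, energy, potential, Fin.sum_univ_three, Matrix.cons_val_zero,
      Matrix.cons_val_one, Matrix.cons_val]
    ring
  simp only [Fin.sum_univ_three] at hsph
  have d0 : ∀ t, HasDerivAt (W' 0) ((4 - E t) * W 0 t) t := fun t =>
    (hW' 0 t).congr_deriv (by simp only [potential, Matrix.cons_val_zero]; ring)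
  have d1 : ∀ t, HasDerivAt (W' 1) (-E t * W 1 t) t := fun t =>
    (hW' 1 t).congr_deriv (by simp only [potential, Matrix.cons_val_one, Matrix.cons_val]; ring)
  have d2 : ∀ t, HasDerivAt (W' 2) ((1 - E t) * W 2 t) t := fun t =>
    (hW' 2 t).congr_deriv (by simp only [potential, Matrix.cons_val]; ring)
  have horth : ∀ t, W 0 t * W' 0 t + W 1 t * W' 1 t + W 2 t * W' 2 t = 0 := fun t => by
    have h1 := (((hW 0 t).pow 2).add ((hW 1 t).pow 2)).add ((hW 2 t).pow 2)
    have h2 : W 0 ^ 2 + W 1 ^ 2 + W 2 ^ 2 = fun _ => 1 := funext hsph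
    rw [h2] at h1
    have := h1.unique (hasDerivAt_const t 1)
    norm_num at this
    linarith [this]
  -- conservation of the Hamiltonian
  set H : ℝ → ℝ := fun t => W' 0 t ^ 2 + W' 1 t ^ 2 + W' 2 t ^ 2 - 4 * W 0 t ^ 2 - W 2 t ^ 2
  have hHd : ∀ t, HasDerivAt H 0 t := fun t => by
    have h1 := ((((d0 t).pow 2).add ((d1 t).pow 2)).add ((d2 t).pow 2)).sub
      (((hW 0 t).pow 2).const_mul 4) |>.sub ((hW 2 t).pow 2)
    refine h1.congr_deriv ?_
    norm_num
    linear_combination -2 * E t * horth t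
  have hHconst : ∀ t, H t = H 0 := fun t =>
    is_const_of_deriv_eq_zero (fun t => (hHd t).differentiableAt) (fun t => (hHd t).deriv) t 0
  have hHint : Integrable H := by
    refine hE.mono' (by fun_prop) (Filter.Eventually.of_forall fun t => ?_)
    rw [hEe, Real.norm_eq_abs, abs_le]
    constructor <;> simp only [H] <;> nlinarith [sq_nonneg (W' 0 t), sq_nonneg (W' 1 t),
      sq_nonneg (W' 2 t), sq_nonneg (W 0 t), sq_nonneg (W 2 t)]
  -- Finite energy on a line of infinite length forces the conserved quantity to be zero.
  have hH0 : H 0 = 0 := const_eq_zero_of_integrable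
    (hHint.congr (Filter.Eventually.of_forall hHconst))
  have hH : ∀ t, W' 0 t ^ 2 + W' 1 t ^ 2 + W' 2 t ^ 2 = 4 * W 0 t ^ 2 + W 2 t ^ 2 := fun t => by
    have := hHconst t
    simp only [hH0, H] at this
    linarith
  -- Zero Hamiltonian turns the energy into twice the potential, which is at most `4` on the sphere.
  -- This bounds the coefficients of the linear equations below.
  have hEbd : ∀ t, 0 ≤ E t ∧ E t ≤ 8 := fun t => by
    rw [hEe, hH]
    constructor <;> nlinarith [hsph t, sq_nonneg (W 0 t), sq_nonneg (W 1 t), sq_nonneg (W 2 t)]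
  -- the angular momentum of the first and third components
  set l : ℝ → ℝ := fun t => W 0 t * W' 2 t - W 2 t * W' 0 t
  have hld : ∀ t, HasDerivAt l (-3 * (W 0 t * W 2 t)) t := fun t =>
    (((hW 0 t).mul (d2 t)).sub ((hW 2 t).mul (d0 t))).congr_deriv (by ring)
  have hlint : Integrable l := by
    refine hE.mono' (by fun_prop) (Filter.Eventually.of_forall fun t => ?_)
    rw [hEe, Real.norm_eq_abs, abs_le]
    constructor <;> simp only [l] <;> nlinarith [sq_nonneg (W 0 t + W' 2 t), sq_nonneg (W 2 t + W' 0 t),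
      sq_nonneg (W 0 t - W' 2 t), sq_nonneg (W 2 t - W' 0 t), sq_nonneg (W' 1 t), sq_nonneg (W 0 t)]
  have hlanti : Antitone l := antitone_of_deriv_nonpos (fun t => (hld t).differentiableAt)
    fun t => by rw [(hld t).deriv]; nlinarith [mul_nonneg (h0 t) (h2 t)]
  have hl0 := eq_zero_of_antitone_of_integrable hlanti hlint
  -- As `l` vanishes identically, so does its derivative; the factor `-3` is nonzero because the two
  -- frequencies differ.
  have hprod : ∀ t, W 0 t * W 2 t = 0 := fun t => by
    have h := hld t
    rw [show l = fun _ => 0 from funext hl0] at h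
    linarith [h.unique (hasDerivAt_const t (0 : ℝ))]
  have hcb0 : ∀ t, |4 - E t| ≤ 8 := fun t => by
    rw [abs_le]; constructor <;> linarith [hEbd t]
  have hcb2 : ∀ t, |1 - E t| ≤ 8 := fun t => by
    rw [abs_le]; constructor <;> linarith [hEbd t]
  rcases eq_zero_or_pos_of_nonneg (hW 0) d0 hcb0 h0 with hz0 | hp0
  · have hz0' : ∀ t, W' 0 t = 0 := fun t => by
      have h := hW 0 t
      rw [show W 0 = fun _ => 0 from funext hz0] at h
      exact h.unique (hasDerivAt_const t (0 : ℝ))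
    rcases eq_zero_or_pos_of_nonneg (hW 2) d2 hcb2 h2 with hz2 | hp2
    · left
      have hsq : EqOn (W 1 ^ 2) ((fun _ => (1 : ℝ)) ^ 2) univ := fun t _ => by
        have := hsph t
        rw [hz0, hz2] at this
        simp only [Pi.pow_apply]
        linarith
      rcases isPreconnected_univ.eq_or_eq_neg_of_sq_eq (hWc 1).continuousOn
        continuous_const.continuousOn hsq (fun {t} _ => one_ne_zero) with h | h
      · exact Or.inl fun t => ⟨hz0 t, h (mem_univ t), hz2 t⟩
      · exact Or.inr fun t => ⟨hz0 t, h (mem_univ t), hz2 t⟩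
    · right; left
      obtain ⟨σ, hσ, β, hβ, h⟩ := exists_kink_of_planar (y := W 1) (p := W 2) one_pos
        (fun t => by have := hsph t; rw [hz0] at this; linarith) hp2 (hW 1) (hW 2) (hW'c 1) (hW'c 2)
        (fun t => by have := hH t; rw [hz0, hz0'] at this; linarith)
      simp only [one_mul] at h
      exact ⟨σ, hσ, β, hβ, fun t => ⟨hz0 t, (h t).1, (h t).2⟩⟩
  · have hz2 : ∀ t, W 2 t = 0 := fun t =>
      (mul_eq_zero.1 (hprod t)).resolve_left (hp0 t).ne'
    have hz2' : ∀ t, W' 2 t = 0 := fun t => by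
      have h := hW 2 t
      rw [show W 2 = fun _ => 0 from funext hz2] at h
      exact h.unique (hasDerivAt_const t (0 : ℝ))
    right; right
    obtain ⟨σ, hσ, β, hβ, h⟩ := exists_kink_of_planar (y := W 1) (p := W 0) two_pos
      (fun t => by have := hsph t; rw [hz2] at this; linarith) hp0 (hW 1) (hW 0) (hW'c 1) (hW'c 0)
      (fun t => by have := hH t; rw [hz2, hz2'] at this; linarith)
    exact ⟨σ, hσ, β, hβ, fun t => ⟨(h t).2, (h t).1, hz2 t⟩⟩

/-! ### Gradients and Laplacians -/

/-- The classical Laplacian. -/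
def lap (f : E3 → ℝ) (x : E3) : ℝ := ∑ i, partialDeriv i (partialDeriv i f) x

/-- `f` is twice continuously differentiable at `x`, with gradient `g` and Laplacian `l`. -/
structure HasGradLap (f : E3 → ℝ) (x : E3) (g : Fin 3 → ℝ) (l : ℝ) : Prop where
  contDiffAt : ContDiffAt ℝ 2 f x
  grad : ∀ i, partialDeriv i f x = g i
  lap_eq : lap f x = l

lemma contDiffAt_partialDeriv {f : E3 → ℝ} {x : E3} (hf : ContDiffAt ℝ 2 f x) (i : Fin 3) :
    ContDiffAt ℝ 1 (partialDeriv i f) x :=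
  (hf.fderiv_right (m := 1) (by norm_num)).clm_apply contDiffAt_const

lemma partialDeriv_congr {f h : E3 → ℝ} {x : E3} (hfh : f =ᶠ[nhds x] h) (i : Fin 3) :
    partialDeriv i f x = partialDeriv i h x := by
  unfold partialDeriv
  rw [hfh.fderiv_eq]

lemma lap_congr {f h : E3 → ℝ} {x : E3} (hfh : f =ᶠ[nhds x] h) : lap f x = lap h x := by
  refine Finset.sum_congr rfl fun i _ => partialDeriv_congr ?_ i
  exact hfh.eventuallyEq_nhds.mono fun y hy => partialDeriv_congr hy i

lemma HasGradLap.congr {f h : E3 → ℝ} {x : E3} {g : Fin 3 → ℝ} {l : ℝ} (hf : HasGradLap f x g l)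
    (hfh : h =ᶠ[nhds x] f) : HasGradLap h x g l :=
  ⟨hf.contDiffAt.congr_of_eventuallyEq hfh, fun i => by rw [partialDeriv_congr hfh, hf.grad],
    by rw [lap_congr hfh, hf.lap_eq]⟩

lemma eventually_contDiffAt {f : E3 → ℝ} {x : E3} (hf : ContDiffAt ℝ 2 f x) :
    ∀ᶠ y in nhds x, ContDiffAt ℝ 2 f y := hf.eventually (by norm_num)

lemma partialDeriv_add {f h : E3 → ℝ} {x : E3} (hf : DifferentiableAt ℝ f x)
    (hh : DifferentiableAt ℝ h x) (i : Fin 3) :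
    partialDeriv i (fun y => f y + h y) x = partialDeriv i f x + partialDeriv i h x := by
  unfold partialDeriv
  rw [fderiv_fun_add hf hh]; rfl

lemma partialDeriv_mul {f h : E3 → ℝ} {x : E3} (hf : DifferentiableAt ℝ f x)
    (hh : DifferentiableAt ℝ h x) (i : Fin 3) :
    partialDeriv i (fun y => f y * h y) x =
      f x * partialDeriv i h x + h x * partialDeriv i f x := by
  unfold partialDeriv
  rw [fderiv_fun_mul hf hh]; simp

lemma partialDeriv_comp {f : E3 → ℝ} {β : ℝ → ℝ} {x : E3} (hf : DifferentiableAt ℝ f x)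
    (hβ : DifferentiableAt ℝ β (f x)) (i : Fin 3) :
    partialDeriv i (fun y => β (f y)) x = deriv β (f x) * partialDeriv i f x := by
  unfold partialDeriv
  have := (hβ.hasDerivAt.comp_hasFDerivAt x hf.hasFDerivAt).fderiv
  simp only [Function.comp_def] at this
  rw [this]; simp

lemma HasGradLap.differentiableAt {f : E3 → ℝ} {x : E3} {g : Fin 3 → ℝ} {l : ℝ}
    (hf : HasGradLap f x g l) : DifferentiableAt ℝ f x := hf.contDiffAt.differentiableAt (by norm_num)

lemma HasGradLap.add {f h : E3 → ℝ} {x : E3} {gf gh : Fin 3 → ℝ} {lf lh : ℝ}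
    (hf : HasGradLap f x gf lf) (hh : HasGradLap h x gh lh) :
    HasGradLap (fun y => f y + h y) x (fun i => gf i + gh i) (lf + lh) := by
  refine ⟨hf.contDiffAt.add hh.contDiffAt, fun i => ?_, ?_⟩
  · rw [partialDeriv_add hf.differentiableAt hh.differentiableAt, hf.grad, hh.grad]
  · rw [← hf.lap_eq, ← hh.lap_eq, lap, lap, lap, ← Finset.sum_add_distrib]
    refine Finset.sum_congr rfl fun i _ => ?_
    have e : partialDeriv i (fun y => f y + h y) =ᶠ[nhds x]
        fun y => partialDeriv i f y + partialDeriv i h y := by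
      filter_upwards [eventually_contDiffAt hf.contDiffAt, eventually_contDiffAt hh.contDiffAt]
        with y h1 h2
      exact partialDeriv_add (h1.differentiableAt (by norm_num)) (h2.differentiableAt (by norm_num)) i
    rw [partialDeriv_congr e, partialDeriv_add
      ((contDiffAt_partialDeriv hf.contDiffAt i).differentiableAt (by norm_num))
      ((contDiffAt_partialDeriv hh.contDiffAt i).differentiableAt (by norm_num))]

lemma HasGradLap.mul {f h : E3 → ℝ} {x : E3} {gf gh : Fin 3 → ℝ} {lf lh : ℝ}
    (hf : HasGradLap f x gf lf) (hh : HasGradLap h x gh lh) :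
    HasGradLap (fun y => f y * h y) x (fun i => f x * gh i + h x * gf i)
      (f x * lh + 2 * ∑ i, gf i * gh i + h x * lf) := by
  refine ⟨hf.contDiffAt.mul hh.contDiffAt, fun i => ?_, ?_⟩
  · rw [partialDeriv_mul hf.differentiableAt hh.differentiableAt, hf.grad, hh.grad]
  · rw [← hf.lap_eq, ← hh.lap_eq, lap, lap, lap, Finset.mul_sum, Finset.mul_sum, Finset.mul_sum,
      ← Finset.sum_add_distrib, ← Finset.sum_add_distrib]
    refine Finset.sum_congr rfl fun i _ => ?_
    have e : partialDeriv i (fun y => f y * h y) =ᶠ[nhds x]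
        fun y => f y * partialDeriv i h y + h y * partialDeriv i f y := by
      filter_upwards [eventually_contDiffAt hf.contDiffAt, eventually_contDiffAt hh.contDiffAt]
        with y h1 h2
      exact partialDeriv_mul (h1.differentiableAt (by norm_num)) (h2.differentiableAt (by norm_num)) i
    have d1 := (contDiffAt_partialDeriv hf.contDiffAt i).differentiableAt (by norm_num)
    have d2 := (contDiffAt_partialDeriv hh.contDiffAt i).differentiableAt (by norm_num)
    rw [partialDeriv_congr e, partialDeriv_add (hf.differentiableAt.fun_mul d2)
      (hh.differentiableAt.fun_mul d1), partialDeriv_mul hf.differentiableAt d2,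
      partialDeriv_mul hh.differentiableAt d1, hf.grad, hh.grad]
    ring

lemma HasGradLap.comp {f : E3 → ℝ} {β : ℝ → ℝ} {x : E3} {gf : Fin 3 → ℝ} {lf : ℝ}
    (hf : HasGradLap f x gf lf) (hβ : ContDiffAt ℝ 2 β (f x)) :
    HasGradLap (fun y => β (f y)) x (fun i => deriv β (f x) * gf i)
      (deriv (deriv β) (f x) * ∑ i, gf i ^ 2 + deriv β (f x) * lf) := by
  refine ⟨hβ.comp x hf.contDiffAt, fun i => ?_, ?_⟩
  · rw [partialDeriv_comp hf.differentiableAt (hβ.differentiableAt (by norm_num)), hf.grad]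
  · rw [← hf.lap_eq, lap, lap, Finset.mul_sum, Finset.mul_sum, ← Finset.sum_add_distrib]
    refine Finset.sum_congr rfl fun i _ => ?_
    have hβe : ∀ᶠ s in nhds (f x), ContDiffAt ℝ 2 β s := hβ.eventually (by norm_num)
    have e : partialDeriv i (fun y => β (f y)) =ᶠ[nhds x]
        fun y => deriv β (f y) * partialDeriv i f y := by
      filter_upwards [eventually_contDiffAt hf.contDiffAt,
        hf.contDiffAt.continuousAt.eventually hβe] with y h1 h2
      exact partialDeriv_comp (h1.differentiableAt (by norm_num)) (h2.differentiableAt (by norm_num)) i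
    have d1 := (contDiffAt_partialDeriv hf.contDiffAt i).differentiableAt (by norm_num)
    have d2 : DifferentiableAt ℝ (deriv β) (f x) := by
      have : ContDiffAt ℝ 1 (deriv β) (f x) := by
        have := (hβ.fderiv_right (m := 1) (by norm_num)).clm_apply
          (contDiffAt_const (c := (1 : ℝ)))
        exact this
      exact this.differentiableAt (by norm_num)
    have d3 : DifferentiableAt ℝ (fun y => deriv β (f y)) x := d2.comp x hf.differentiableAt
    rw [partialDeriv_congr e, partialDeriv_mul d3 d1, partialDeriv_comp hf.differentiableAt d2,
      hf.grad]
    ring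

lemma partialDeriv_coord (i j : Fin 3) (x : E3) :
    partialDeriv i (fun y : E3 => y j) x = if i = j then 1 else 0 := by
  unfold partialDeriv
  have : HasFDerivAt (fun y : E3 => y j) (EuclideanSpace.proj (𝕜 := ℝ) j) x :=
    (EuclideanSpace.proj (𝕜 := ℝ) j).hasFDerivAt
  rw [this.fderiv]
  simp [eq_comm]

lemma hasGradLap_coord (j : Fin 3) (x : E3) :
    HasGradLap (fun y : E3 => y j) x (fun i => if i = j then 1 else 0) 0 := by
  refine ⟨(EuclideanSpace.proj (𝕜 := ℝ) j).contDiff.contDiffAt, fun i => partialDeriv_coord i j x, ?_⟩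
  refine Finset.sum_eq_zero fun i _ => ?_
  have : partialDeriv i (fun y : E3 => y j) = fun _ => if i = j then 1 else 0 :=
    funext fun y => partialDeriv_coord i j y
  rw [this]
  simp [partialDeriv]

/-! ### Gradients and Laplacians of the radii, the latitude and the angular factors. -/

/-- The square of the cylindrical radius. -/
def rhoSq (x : E3) : ℝ := x 0 ^ 2 + x 1 ^ 2

lemma HasGradLap.congr_val {f : E3 → ℝ} {x : E3} {g g' : Fin 3 → ℝ} {l l' : ℝ}
    (hf : HasGradLap f x g l) (hg : ∀ i, g i = g' i) (hl : l = l') : HasGradLap f x g' l' :=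
  ⟨hf.contDiffAt, fun i => (hf.grad i).trans (hg i), hf.lap_eq.trans hl⟩

lemma hasGradLap_rhoSq (x : E3) : HasGradLap rhoSq x ![2 * x 0, 2 * x 1, 0] 4 := by
  have h := ((hasGradLap_coord 0 x).mul (hasGradLap_coord 0 x)).add
    ((hasGradLap_coord 1 x).mul (hasGradLap_coord 1 x))
  refine (h.congr (Filter.Eventually.of_forall fun y => ?_)).congr_val (fun i => ?_) ?_
  · simp only [rhoSq]; ring
  · fin_cases i <;> simp <;> ring
  · simp; norm_num

lemma normSq_eq (x : E3) : ‖x‖ ^ 2 = rhoSq x + x 2 ^ 2 := by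
  rw [EuclideanSpace.norm_sq_eq, Fin.sum_univ_three]
  simp [rhoSq]

lemma hasGradLap_normSq (x : E3) :
    HasGradLap (fun y => ‖y‖ ^ 2) x ![2 * x 0, 2 * x 1, 2 * x 2] 6 := by
  have h := (hasGradLap_rhoSq x).add ((hasGradLap_coord 2 x).mul (hasGradLap_coord 2 x))
  refine (h.congr (Filter.Eventually.of_forall fun y => ?_)).congr_val (fun i => ?_) ?_
  · simp only [normSq_eq]; ring
  · fin_cases i <;> simp; ring
  · simp; norm_num

lemma rho_eq (x : E3) : rho x = √(rhoSq x) := rfl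

lemma rhoSq_nonneg (x : E3) : 0 ≤ rhoSq x := by unfold rhoSq; positivity

lemma rho_sq (x : E3) : rho x ^ 2 = rhoSq x := Real.sq_sqrt (rhoSq_nonneg x)

lemma rho_pos {x : E3} (hx : 0 < rhoSq x) : 0 < rho x := Real.sqrt_pos.2 hx

lemma hasGradLap_rho_inv {x : E3} (hx : 0 < rhoSq x) :
    HasGradLap (fun y => (rho y)⁻¹) x ![-x 0 / rho x ^ 3, -x 1 / rho x ^ 3, 0] (1 / rho x ^ 3) := by
  have hr := rho_pos hx
  have hd : ∀ s : ℝ, 0 < s → HasDerivAt (fun s => (√s)⁻¹) (-(1 / 2) * (√s)⁻¹ ^ 3) s := by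
    intro s hs
    have h1 := (Real.hasDerivAt_sqrt hs.ne').inv (Real.sqrt_pos.2 hs).ne'
    refine h1.congr_deriv ?_
    have := (Real.sqrt_pos.2 hs).ne'
    field_simp
  have hd2 : HasDerivAt (deriv fun s => (√s)⁻¹) (3 / 4 * (√(rhoSq x))⁻¹ ^ 5) (rhoSq x) := by
    have h1 := ((hd _ hx).pow 3).const_mul (-(1 / 2))
    refine (h1.congr_of_eventuallyEq ?_).congr_deriv ?_
    · filter_upwards [lt_mem_nhds hx] with s hs using (hd s hs).deriv
    · norm_num; ring
  have h := (hasGradLap_rhoSq x).comp (β := fun s => (√s)⁻¹)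
    ((Real.contDiffAt_sqrt hx.ne').inv (Real.sqrt_pos.2 hx).ne')
  rw [hd2.deriv, (hd _ hx).deriv, ← rho_eq] at h
  refine h.congr_val (fun i => ?_) ?_
  · fin_cases i <;> simp <;> ring
  · have e := rho_sq x
    simp only [Fin.sum_univ_three, Matrix.cons_val_zero, Matrix.cons_val_one, Matrix.cons_val]
    rw [show (2 * x 0) ^ 2 + (2 * x 1) ^ 2 + (0 : ℝ) ^ 2 = 4 * rho x ^ 2 by
      rw [e, rhoSq]; ring]
    field_simp
    norm_num

lemma sqrt_one_add_slope {x : E3} (hx : 0 < rhoSq x) :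
    √(1 + (x 2 / rho x) ^ 2) = ‖x‖ / rho x := by
  have hr := rho_pos hx
  rw [show 1 + (x 2 / rho x) ^ 2 = (‖x‖ / rho x) ^ 2 by
    rw [div_pow, div_pow, normSq_eq, ← rho_sq]; field_simp]
  exact Real.sqrt_sq (by positivity)

lemma norm_pos_of_rhoSq {x : E3} (hx : 0 < rhoSq x) : 0 < ‖x‖ := by
  have := normSq_eq x
  by_contra h
  have h0 : ‖x‖ = 0 := le_antisymm (not_lt.1 h) (norm_nonneg x)
  rw [h0] at this
  nlinarith [sq_nonneg (x 2)]

/-- The vanishing Laplacian is what makes this latitude the right variable: no first order term in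
`t` appears in the reduced equation. -/
lemma hasGradLap_lat {x : E3} (hx : 0 < rhoSq x) :
    HasGradLap lat x ![-x 2 * x 0 / (rhoSq x * ‖x‖), -x 2 * x 1 / (rhoSq x * ‖x‖), 1 / ‖x‖] 0 := by
  have hr := rho_pos hx
  have hn := norm_pos_of_rhoSq hx
  have hs := (hasGradLap_coord 2 x).mul (hasGradLap_rho_inv hx)
  have hda : ∀ s : ℝ, HasDerivAt Real.arsinh (√(1 + s ^ 2))⁻¹ s := Real.hasDerivAt_arsinh
  have hde : deriv Real.arsinh = fun s => (√(1 + s ^ 2))⁻¹ := funext fun s => (hda s).deriv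
  have hd2 : ∀ s : ℝ, deriv (deriv Real.arsinh) s = -s * (√(1 + s ^ 2))⁻¹ ^ 3 := fun s => by
    rw [hde]
    have hp : 0 < 1 + s ^ 2 := by positivity
    have h1 := ((((hasDerivAt_id s).pow 2).const_add 1).sqrt hp.ne').inv (Real.sqrt_pos.2 hp).ne'
    refine (h1.congr_deriv ?_).deriv
    have := (Real.sqrt_pos.2 hp).ne'
    simp only [id, Pi.pow_apply]
    field_simp
    norm_num
  have h := hs.comp (β := Real.arsinh) Real.contDiff_arsinh.contDiffAt
  rw [hd2, hde] at h
  have e1 : x 2 * (rho x)⁻¹ = x 2 / rho x := rfl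
  simp only [e1, sqrt_one_add_slope hx] at h
  have e2 := rho_sq x
  have e3 := normSq_eq x
  have e4 : rhoSq x = x 0 ^ 2 + x 1 ^ 2 := rfl
  refine h.congr_val (fun i => ?_) ?_
  · rw [← e2]
    fin_cases i <;> simp <;> field_simp
  · simp [Fin.sum_univ_three]
    field_simp
    rw [mul_zero, ← e4, e3, ← e2]
    ring

lemma hasGradLap_cos {x : E3} (hx : 0 < rhoSq x) :
    HasGradLap (fun y => y 0 * (rho y)⁻¹) x ![x 1 ^ 2 / rho x ^ 3, -(x 0 * x 1) / rho x ^ 3, 0]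
      (-(x 0 * (rho x)⁻¹) / rhoSq x) := by
  have hr := rho_pos hx
  have e2 := rho_sq x
  have e4 : rhoSq x = x 0 ^ 2 + x 1 ^ 2 := rfl
  refine ((hasGradLap_coord 0 x).mul (hasGradLap_rho_inv hx)).congr_val (fun i => ?_) ?_
  · fin_cases i
    · simp; field_simp; rw [e2, e4]; ring
    · simp; field_simp
    · simp
  · simp; rw [← e2]; field_simp; norm_num

lemma hasGradLap_sin {x : E3} (hx : 0 < rhoSq x) :
    HasGradLap (fun y => y 1 * (rho y)⁻¹) x ![-(x 0 * x 1) / rho x ^ 3, x 0 ^ 2 / rho x ^ 3, 0]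
      (-(x 1 * (rho x)⁻¹) / rhoSq x) := by
  have hr := rho_pos hx
  have e2 := rho_sq x
  have e4 : rhoSq x = x 0 ^ 2 + x 1 ^ 2 := rfl
  refine ((hasGradLap_coord 1 x).mul (hasGradLap_rho_inv hx)).congr_val (fun i => ?_) ?_
  · fin_cases i
    · simp; field_simp
    · simp; field_simp; rw [e2, e4]; ring
    · simp
  · simp; rw [← e2]; field_simp; norm_num

/-- The index of the profile that enters the `j`-th component of the augmented map. -/
def profileIndex : Fin 5 → Fin 3 := ![0, 0, 1, 2, 2]

/-- The angular factor of the `j`-th component of the augmented map. The factor `1` of the third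
component is written in a form that vanishes on the axis. -/
def angular : Fin 5 → E3 → ℝ :=
  ![fun x => (x 0 * (rho x)⁻¹) * (x 0 * (rho x)⁻¹) + (-1) * ((x 1 * (rho x)⁻¹) * (x 1 * (rho x)⁻¹)),
    fun x => 2 * ((x 0 * (rho x)⁻¹) * (x 1 * (rho x)⁻¹)),
    fun x => (x 0 * (rho x)⁻¹) * (x 0 * (rho x)⁻¹) + (x 1 * (rho x)⁻¹) * (x 1 * (rho x)⁻¹),
    fun x => x 0 * (rho x)⁻¹, fun x => x 1 * (rho x)⁻¹]

lemma hasGradLap_const (c : ℝ) (x : E3) : HasGradLap (fun _ => c) x (fun _ => 0) 0 := by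
  have h : ∀ i, partialDeriv i (fun _ : E3 => c) = fun _ => 0 := fun i => by
    funext y; simp [partialDeriv]
  refine ⟨contDiffAt_const, fun i => by rw [h], ?_⟩
  refine Finset.sum_eq_zero fun i _ => ?_
  rw [h]; simp [partialDeriv]

/-- These are functions of the azimuth alone, with frequencies `2, 2, 0, 1, 1`, and on such
functions the Laplacian is `ρ⁻² ∂θ²`; the gradient points in the azimuthal direction. -/
lemma hasGradLap_angular (j : Fin 5) {x : E3} (hx : 0 < rhoSq x) :
    ∃ g, HasGradLap (angular j) x g (-potential (profileIndex j) * angular j x / rhoSq x) ∧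
      g 0 * x 0 + g 1 * x 1 = 0 ∧ g 2 = 0 := by
  have hr := rho_pos hx
  have e2 := rho_sq x
  have e4 : rhoSq x = x 0 ^ 2 + x 1 ^ 2 := rfl
  have e5 : rho x ^ 2 = x 0 ^ 2 + x 1 ^ 2 := e2
  have hc := hasGradLap_cos hx
  have hs := hasGradLap_sin hx
  fin_cases j
  · refine ⟨_, ((hc.mul hc).add ((hasGradLap_const (-1) x).mul (hs.mul hs))).congr_val
      (fun i => rfl) ?_, ?_, ?_⟩
    · simp [Fin.sum_univ_three, potential, profileIndex, angular]
      rw [← e2]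
      field_simp
      rw [e5]; ring
    · simp; field_simp; ring
    · simp
  · refine ⟨_, ((hasGradLap_const 2 x).mul (hc.mul hs)).congr_val (fun i => rfl) ?_, ?_, ?_⟩
    · simp [Fin.sum_univ_three, potential, profileIndex, angular]
      rw [← e2]
      field_simp
      rw [e5]; ring
    · simp; field_simp; ring
    · simp
  · refine ⟨_, ((hc.mul hc).add (hs.mul hs)).congr_val (fun i => rfl) ?_, ?_, ?_⟩
    · simp [Fin.sum_univ_three, potential, profileIndex, angular]
      rw [← e2]
      field_simp
      rw [mul_zero, e5]; ring
    · simp; field_simp; ring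
    · simp
  · refine ⟨_, hc.congr_val (fun i => rfl) ?_, ?_, ?_⟩
    · simp [potential, profileIndex, angular]
    · simp; field_simp; ring
    · simp
  · refine ⟨_, hs.congr_val (fun i => rfl) ?_, ?_, ?_⟩
    · simp [potential, profileIndex, angular]
    · simp; field_simp; ring
    · simp

/-- The separated test functions. -/
def separated (χ η : ℝ → ℝ) (j : Fin 5) (x : E3) : ℝ := χ (‖x‖ ^ 2) * η (lat x) * angular j x

/-- The gradients of `‖x‖²`, of the latitude and of the angular factor are mutually orthogonal, so
no cross terms survive. The latitude is harmonic with squared gradient `1 / ρ²`, which matches the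
weight of the angular eigenvalue. -/
lemma lap_separated {χ η : ℝ → ℝ} (hχ : ContDiff ℝ 2 χ) (hη : ContDiff ℝ 2 η) (j : Fin 5) {x : E3}
    (hx : 0 < rhoSq x) :
    ContDiffAt ℝ 2 (separated χ η j) x ∧ lap (separated χ η j) x = angular j x *
      (χ (‖x‖ ^ 2) * (deriv (deriv η) (lat x) - potential (profileIndex j) * η (lat x)) / rhoSq x +
        η (lat x) * (4 * ‖x‖ ^ 2 * deriv (deriv χ) (‖x‖ ^ 2) + 6 * deriv χ (‖x‖ ^ 2))) := by
  have hn := norm_pos_of_rhoSq hx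
  obtain ⟨g, hg, hg01, hg2⟩ := hasGradLap_angular j hx
  have h := (((hasGradLap_normSq x).comp (β := χ) hχ.contDiffAt).mul
    ((hasGradLap_lat hx).comp (β := η) hη.contDiffAt)).mul hg
  refine ⟨h.contDiffAt, h.lap_eq.trans ?_⟩
  have e3 := normSq_eq x
  have e4 : rhoSq x = x 0 ^ 2 + x 1 ^ 2 := rfl
  have hT : (x 2 * x 0 / (rhoSq x * ‖x‖)) ^ 2 + (x 2 * x 1 / (rhoSq x * ‖x‖)) ^ 2 + (1 / ‖x‖) ^ 2 =
      1 / rhoSq x := by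
    field_simp
    rw [e3, e4]; ring
  have hR : (2 * x 0) ^ 2 + (2 * x 1) ^ 2 + (2 * x 2) ^ 2 = 4 * ‖x‖ ^ 2 := by rw [e3, e4]; ring
  have hRT : x 0 * (-(x 2 * x 0) / (rhoSq x * ‖x‖)) + x 1 * (-(x 2 * x 1) / (rhoSq x * ‖x‖)) +
      x 2 * (1 / ‖x‖) = 0 := by
    field_simp
    rw [e4]; ring
  simp only [Fin.sum_univ_three, Matrix.cons_val_zero, Matrix.cons_val_one, Matrix.cons_val, hg2]
  linear_combination (2 * χ (‖x‖ ^ 2) * deriv η (lat x) * (-x 2 / (rhoSq x * ‖x‖)) +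
    4 * η (lat x) * deriv χ (‖x‖ ^ 2)) * hg01 +
    angular j x * χ (‖x‖ ^ 2) * deriv (deriv η) (lat x) * hT +
    angular j x * η (lat x) * deriv (deriv χ) (‖x‖ ^ 2) * hR +
    4 * angular j x * deriv χ (‖x‖ ^ 2) * deriv η (lat x) * hRT

/-! ### Test functions and the weak equation -/

lemma IsTestFunction.partialDeriv {Ω : Set E3} {ψ : E3 → ℝ} (h : IsTestFunction Ω ψ) (i : Fin 3) :
    IsTestFunction Ω (AxialHarmonic.partialDeriv i ψ) :=
  ⟨(h.1.fderiv_right (m := ∞) (by simp)).clm_apply contDiff_const, h.2.1.fderiv_apply (𝕜 := ℝ) _,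
    (tsupport_fderiv_apply_subset ℝ _).trans h.2.2⟩

lemma IsTestFunction.continuous {Ω : Set E3} {ψ : E3 → ℝ} (h : IsTestFunction Ω ψ) :
    Continuous ψ := h.1.continuous

lemma IsTestFunction.memLp {Ω : Set E3} {ψ : E3 → ℝ} (h : IsTestFunction Ω ψ) (p : ENNReal)
    (μ : Measure E3) [IsFiniteMeasureOnCompacts μ] : MemLp ψ p μ :=
  h.continuous.memLp_of_hasCompactSupport h.2.1

/-- The energy density of a harmonic map enters its equation as an integrable multiplier. -/
lemma IsHarmonicMap.exists_multiplier {Ω : Set E3} {w : E3 → E5} (h : IsHarmonicMap Ω w) :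
    ∃ e : E3 → ℝ, (∀ x, 0 ≤ e x) ∧ IntegrableOn e Ω ∧ ∀ (j : Fin 5) (ψ : E3 → ℝ),
      IsTestFunction Ω ψ → ∫ x in Ω, w x j * lap ψ x = -∫ x in Ω, e x * (w x j * ψ x) := by
  obtain ⟨G, hw, hG, hweak, -, heq⟩ := h
  refine ⟨fun x => ∑ i, ‖G i x‖ ^ 2, fun x => by positivity,
    integrable_finsetSum _ fun i _ => (hG i).integrable_norm_pow two_ne_zero, fun j ψ hψ => ?_⟩
  have hGj : ∀ i, MemLp (fun x => G i x j) 2 (volume.restrict Ω) := fun i =>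
    (EuclideanSpace.proj (𝕜 := ℝ) j).comp_memLp' (hG i)
  have hwj : MemLp (fun x => w x j) 2 (volume.restrict Ω) :=
    (EuclideanSpace.proj (𝕜 := ℝ) j).comp_memLp' hw
  have hζ : IsTestFunction Ω fun x => ψ x • (EuclideanSpace.single j 1 : E5) :=
    ⟨hψ.1.smul contDiff_const, hψ.2.1.smul_right,
      (tsupport_smul_subset_left ψ fun _ => (EuclideanSpace.single j 1 : E5)).trans hψ.2.2⟩
  have hpd : ∀ i x, AxialHarmonic.partialDeriv i (fun x => ψ x • (EuclideanSpace.single j 1 : E5)) x =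
      AxialHarmonic.partialDeriv i ψ x • (EuclideanSpace.single j 1 : E5) := fun i x => by
    unfold AxialHarmonic.partialDeriv
    rw [fderiv_smul_const (hψ.1.differentiable (by simp) x)]
    simp
  have hin : ∀ (y : E5) (c : ℝ), inner ℝ y (c • (EuclideanSpace.single j 1 : E5)) = c * y j := by
    intro y c
    rw [inner_smul_right, EuclideanSpace.inner_single_right]
    simp
  have h1 := heq _ hζ
  simp only [hpd, hin] at h1
  -- The definition of weak derivative, applied to the test function `∂ᵢψ`, moves the remaining
  -- derivative off `w`.
  have hcoord : ∀ i, ∫ x in Ω, AxialHarmonic.partialDeriv i (AxialHarmonic.partialDeriv i ψ) x * w x j =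
      -∫ x in Ω, AxialHarmonic.partialDeriv i ψ x * G i x j := fun i => by
    have h2 := hweak i _ (hψ.partialDeriv i)
    have i1 : Integrable (fun x => AxialHarmonic.partialDeriv i (AxialHarmonic.partialDeriv i ψ) x • w x)
        (volume.restrict Ω) :=
      memLp_one_iff_integrable.1 (hw.smul (((hψ.partialDeriv i).partialDeriv i).memLp 2 _))
    have i2 : Integrable (fun x => AxialHarmonic.partialDeriv i ψ x • G i x) (volume.restrict Ω) :=
      memLp_one_iff_integrable.1 ((hG i).smul ((hψ.partialDeriv i).memLp 2 _))
    have h3 := congrArg (EuclideanSpace.proj (𝕜 := ℝ) j) h2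
    rw [map_neg, ← ContinuousLinearMap.integral_comp_comm _ i1,
      ← ContinuousLinearMap.integral_comp_comm _ i2] at h3
    simpa using h3
  have e1 : ∫ x in Ω, w x j * lap ψ x =
      ∑ i, ∫ x in Ω, AxialHarmonic.partialDeriv i (AxialHarmonic.partialDeriv i ψ) x * w x j := by
    rw [← integral_finsetSum]
    · refine integral_congr_ae (Filter.Eventually.of_forall fun x => ?_)
      simp only [lap, Finset.mul_sum, mul_comm]
    · intro i _
      exact MemLp.integrable_mul (p := 2) (q := 2)
        (((hψ.partialDeriv i).partialDeriv i).memLp 2 _) hwj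
  have i3 : ∀ i, Integrable (fun x => AxialHarmonic.partialDeriv i ψ x * G i x j)
      (volume.restrict Ω) := fun i =>
    MemLp.integrable_mul (p := 2) (q := 2) ((hψ.partialDeriv i).memLp 2 _) (hGj i)
  rw [integral_finsetSum _ fun i _ => i3 i] at h1
  rw [e1, Finset.sum_congr rfl fun i _ => hcoord i, Finset.sum_neg_distrib, h1]
  simp only [mul_comm (ψ _)]

/-- Uses `0⁻¹ = 0`. It is needed because the value of `lat` on the axis is the default `0`, where
`η` need not vanish. -/
lemma angular_eq_zero (j : Fin 5) {x : E3} (hx : rho x = 0) : angular j x = 0 := by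
  fin_cases j <;> simp [angular, hx]

lemma continuous_rho : Continuous rho := by unfold rho; fun_prop

lemma abs_le_of_abs_arsinh_le {s N : ℝ} (h : |Real.arsinh s| ≤ N) : |s| ≤ Real.sinh N := by
  rw [abs_le] at h ⊢
  rw [← Real.sinh_neg, ← Real.sinh_arsinh s, Real.sinh_le_sinh, Real.sinh_le_sinh]
  exact h

/-- Smoothness can fail only on the axis, and the cutoffs in the radius and the latitude confine the
support to a compact set off it. -/
lemma separated_isTestFunction {χ η : ℝ → ℝ} (hχ : IsTest χ) (hχs : tsupport χ ⊆ Ioo 0 1)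
    (hη : IsTest η) (j : Fin 5) : IsTestFunction B1 (separated χ η j) := by
  obtain ⟨N, hN, hNs⟩ := hη.exists_support_subset
  -- The second condition is `|lat x| ≤ N` cleared of its denominator, so that it is closed even at
  -- the axis.
  set K : Set E3 := {x | ‖x‖ ^ 2 ∈ tsupport χ ∧ |x 2| ≤ Real.sinh N * rho x} with hK
  have hKcl : IsClosed K :=
    ((isClosed_tsupport χ).preimage (by fun_prop)).inter
      (isClosed_le (by fun_prop) (continuous_const.mul continuous_rho))
  have hKB : K ⊆ B1 := fun x hx => by
    have := (hχs hx.1).2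
    rw [B1, mem_ball_zero_iff]
    nlinarith [norm_nonneg x]
  have hKO : ∀ x ∈ K, 0 < rhoSq x := fun x hx => by
    refine lt_of_le_of_ne (rhoSq_nonneg x) fun h0 => ?_
    have h2 := hx.2
    rw [rho_eq, ← h0, Real.sqrt_zero, mul_zero, abs_nonpos_iff] at h2
    have h3 := (hχs hx.1).1
    rw [normSq_eq, ← h0, h2] at h3
    simp at h3
  have hKc : IsCompact K := (isCompact_closedBall (0 : E3) 1).of_isClosed_subset hKcl
    (hKB.trans Metric.ball_subset_closedBall)
  have hzero : ∀ x, x ∉ K → separated χ η j x = 0 := fun x hx => by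
    unfold separated
    by_cases h1 : ‖x‖ ^ 2 ∈ tsupport χ
    · by_cases h0 : rho x = 0
      · rw [angular_eq_zero j h0, mul_zero]
      · have hr : 0 < rho x := lt_of_le_of_ne (Real.sqrt_nonneg _) (Ne.symm h0)
        have : η (lat x) = 0 := by
          by_contra h2
          have h3 := hNs (subset_tsupport _ h2)
          have h4 := abs_le_of_abs_arsinh_le (abs_le.2 ⟨h3.1.le, h3.2.le⟩)
          rw [abs_div, abs_of_pos hr, div_le_iff₀ hr] at h4
          exact hx ⟨h1, h4⟩
        rw [this]; ring
    · rw [image_eq_zero_of_notMem_tsupport h1]; ring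
  have hts : tsupport (separated χ η j) ⊆ K := by
    refine closure_minimal (fun x hx => ?_) hKcl
    by_contra h
    exact hx (hzero x h)
  refine ⟨?_, HasCompactSupport.of_support_subset_isCompact hKc ((subset_tsupport _).trans hts),
    hts.trans hKB⟩
  rw [contDiff_iff_contDiffAt]
  intro x
  by_cases hx : x ∈ K
  · have hq := hKO x hx
    have hr := rho_pos hq
    have hc : ∀ k : Fin 3, ContDiffAt ℝ ∞ (fun y : E3 => y k) x := fun k =>
      (EuclideanSpace.proj (𝕜 := ℝ) k).contDiff.contDiffAt
    have hρ : ContDiffAt ℝ ∞ rho x :=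
      ContDiffAt.sqrt (((hc 0).pow 2).add ((hc 1).pow 2)) hq.ne'
    have hρi : ContDiffAt ℝ ∞ (fun y => (rho y)⁻¹) x := hρ.inv hr.ne'
    have hlat : ContDiffAt ℝ ∞ lat x :=
      Real.contDiff_arsinh.contDiffAt.comp x ((hc 2).div hρ hr.ne')
    have hn : ContDiffAt ℝ ∞ (fun y : E3 => ‖y‖ ^ 2) x := (contDiff_norm_sq ℝ).contDiffAt
    have ha : ContDiffAt ℝ ∞ (angular j) x := by
      have c1 := (hc 0).mul hρi
      have c2 := (hc 1).mul hρi
      fin_cases j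
      · exact (c1.mul c1).add (contDiffAt_const.mul (c2.mul c2))
      · exact contDiffAt_const.mul (c1.mul c2)
      · exact (c1.mul c1).add (c2.mul c2)
      · exact c1
      · exact c2
    exact ((hχ.1.contDiffAt.comp x hn).mul (hη.1.contDiffAt.comp x hlat)).mul ha
  · have : separated χ η j =ᶠ[nhds x] fun _ => 0 := by
      filter_upwards [hKcl.isOpen_compl.mem_nhds hx] with y hy using hzero y hy
    exact contDiffAt_const.congr_of_eventuallyEq this

lemma IsTestFunction.lap {Ω : Set E3} {ψ : E3 → ℝ} (h : IsTestFunction Ω ψ) :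
    Continuous (AxialHarmonic.lap ψ) ∧ HasCompactSupport (AxialHarmonic.lap ψ) := by
  have hc : Continuous (AxialHarmonic.lap ψ) :=
    continuous_finsetSum _ fun i _ => ((h.partialDeriv i).partialDeriv i).continuous
  have hs : AxialHarmonic.lap ψ = fun x =>
      AxialHarmonic.partialDeriv 0 (AxialHarmonic.partialDeriv 0 ψ) x +
      AxialHarmonic.partialDeriv 1 (AxialHarmonic.partialDeriv 1 ψ) x +
      AxialHarmonic.partialDeriv 2 (AxialHarmonic.partialDeriv 2 ψ) x := by
    funext x; simp [AxialHarmonic.lap, Fin.sum_univ_three]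
  refine ⟨hc, ?_⟩
  rw [hs]
  exact (((h.partialDeriv 0).partialDeriv 0).2.1.add ((h.partialDeriv 1).partialDeriv 1).2.1).add
    ((h.partialDeriv 2).partialDeriv 2).2.1

/-! ### The augmented map in Mercator coordinates -/

/-- The profile as a function of the latitude. -/
def latProfile (v : ℝ → EuclideanSpace ℝ (Fin 3)) (k : Fin 3) (t : ℝ) : ℝ :=
  v (Real.arccos (Real.tanh t)) k

/-- This is what removes the azimuth: adding the equations of all components that share a profile
leaves a function of radius and latitude only. -/
lemma sum_angular_sq (k : Fin 3) {x : E3} (hx : 0 < rhoSq x) :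
    ∑ j, (if profileIndex j = k then angular j x ^ 2 else 0) = 1 := by
  have hr := rho_pos hx
  have e : (x 0 * (rho x)⁻¹) ^ 2 + (x 1 * (rho x)⁻¹) ^ 2 = 1 := by
    have : rho x ^ 2 = x 0 ^ 2 + x 1 ^ 2 := rho_sq x
    field_simp
    exact this.symm
  fin_cases k <;> simp [Fin.sum_univ_five, profileIndex, angular]
  · linear_combination ((x 0 * (rho x)⁻¹) ^ 2 + (x 1 * (rho x)⁻¹) ^ 2 + 1) * e
  · left; linear_combination e
  · linear_combination e

lemma tanh_lat {x : E3} (hx : 0 < rhoSq x) : Real.tanh (lat x) = x 2 / ‖x‖ := by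
  have hr := rho_pos hx
  have hn := norm_pos_of_rhoSq hx
  rw [Real.tanh_eq_sinh_div_cosh, lat, Real.sinh_arsinh, Real.cosh_arsinh, sqrt_one_add_slope hx]
  field_simp

lemma augmentPolar_eq (v : ℝ → EuclideanSpace ℝ (Fin 3)) (j : Fin 5) {x : E3} (hx : 0 < rhoSq x) :
    augmentPolar v x j = latProfile v (profileIndex j) (lat x) * angular j x := by
  have hr := rho_pos hx
  have hne : (⟨x 0, x 1⟩ : ℂ) ≠ 0 := fun h => by
    have h0 : x 0 = 0 := by simpa using congrArg Complex.re h
    have h1 : x 1 = 0 := by simpa using congrArg Complex.im h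
    simp [rhoSq, h0, h1] at hx
  have hnorm : ‖(⟨x 0, x 1⟩ : ℂ)‖ = rho x := by
    rw [Complex.norm_def, Complex.normSq_mk, rho]; ring_nf
  have hcos : Real.cos (azimuth x) = x 0 * (rho x)⁻¹ := by
    rw [azimuth, Complex.cos_arg hne, hnorm]; rfl
  have hsin : Real.sin (azimuth x) = x 1 * (rho x)⁻¹ := by
    rw [azimuth, Complex.sin_arg, hnorm]; rfl
  have e : (x 0 * (rho x)⁻¹) * (x 0 * (rho x)⁻¹) + (x 1 * (rho x)⁻¹) * (x 1 * (rho x)⁻¹) = 1 := by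
    rw [← hcos, ← hsin]; linarith [Real.sin_sq_add_cos_sq (azimuth x)]
  have hpol : polarAngle x = Real.arccos (Real.tanh (lat x)) := by rw [tanh_lat hx, polarAngle]
  fin_cases j <;> simp [augmentPolar, augment, latProfile, profileIndex, angular, hpol,
    Real.cos_two_mul', Real.sin_two_mul, hcos, hsin]
  · left; ring
  · left; ring
  · rw [e, mul_one]

/-! ### Integration in Mercator coordinates -/

lemma mercator_spec {p : ℝ × ℝ × ℝ} (hp : 0 < p.1) :
    0 < rhoSq (mercator p) ∧ lat (mercator p) = p.2.1 ∧ ‖mercator p‖ = p.1 := by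
  have hc := Real.cosh_pos p.2.1
  have h1 : rho (mercator p) = p.1 * (Real.cosh p.2.1)⁻¹ :=
    rho_mercatorPi (p := ![p.1, p.2.1, p.2.2]) hp.le
  have h2 : rhoSq (mercator p) = (p.1 * (Real.cosh p.2.1)⁻¹) ^ 2 := by rw [← rho_sq, h1]
  refine ⟨by rw [h2]; positivity, lat_mercatorPi (p := ![p.1, p.2.1, p.2.2]) hp, ?_⟩
  rw [← sq_eq_sq₀ (norm_nonneg _) hp.le, normSq_eq, h2]
  have h3 : mercator p 2 = p.1 * Real.tanh p.2.1 := rfl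
  rw [h3, Real.tanh_eq_sinh_div_cosh]
  have e := Real.cosh_sq p.2.1
  field_simp
  rw [e]; ring

lemma rhoSq_eq_norm_div_cosh {x : E3} (hx : 0 < rhoSq x) :
    rhoSq x = ‖x‖ ^ 2 / Real.cosh (lat x) ^ 2 := by
  have hr := rho_pos hx
  have hn := norm_pos_of_rhoSq hx
  rw [lat, Real.cosh_arsinh, sqrt_one_add_slope hx, ← rho_sq]
  field_simp

lemma ae_pos_mercatorMeasure : ∀ᵐ p ∂mercatorMeasure, 0 < p.1 := by
  have h1 : ∀ᵐ r ∂radialMeasure, 0 < r :=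
    (withDensity_absolutelyContinuous _ _).ae_le (ae_restrict_mem measurableSet_Ioi)
  exact Measure.quasiMeasurePreserving_fst.ae h1

lemma ae_rhoSq_pos : ∀ᵐ x : E3, 0 < rhoSq x := by
  rw [← measurePreserving_mercator.map_eq]
  have hm : MeasurableSet {x : E3 | 0 < rhoSq x} :=
    measurableSet_lt measurable_const (by unfold rhoSq; fun_prop)
  rw [ae_map_iff measurePreserving_mercator.measurable.aemeasurable hm]
  filter_upwards [ae_pos_mercatorMeasure] with p hp using (mercator_spec hp).1

lemma measurable_lat : Measurable lat :=
  Real.continuous_arsinh.measurable.comp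
    (Measurable.div (by fun_prop) continuous_rho.measurable)

lemma quasiMeasurePreserving_lat : Measure.QuasiMeasurePreserving lat (volume : Measure E3) volume := by
  refine ⟨measurable_lat, Measure.AbsolutelyContinuous.mk fun s hs h0 => ?_⟩
  rw [Measure.map_apply measurable_lat hs, ← measurePreserving_mercator.map_eq,
    Measure.map_apply measurePreserving_mercator.measurable (measurable_lat hs)]
  have h1 : ∀ᵐ t ∂latMeasure, t ∉ s :=
    (withDensity_absolutelyContinuous _ _).ae_le (measure_eq_zero_iff_ae_notMem.1 h0)
  have h2 : ∀ᵐ p ∂mercatorMeasure, p.2.1 ∉ s :=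
    (Measure.quasiMeasurePreserving_fst.comp Measure.quasiMeasurePreserving_snd).ae h1
  rw [measure_eq_zero_iff_ae_notMem]
  filter_upwards [h2, ae_pos_mercatorMeasure] with p hp hpos
  simpa only [mem_preimage, (mercator_spec hpos).2.1] using hp

lemma volume_ac_latMeasure : (volume : Measure ℝ) ≪ latMeasure :=
  withDensity_absolutelyContinuous' (by fun_prop) (Filter.Eventually.of_forall fun t => by
    have := Real.cosh_pos t
    simp only [ne_eq, ENNReal.ofReal_eq_zero, not_le]
    positivity)

lemma volume_restrict_ac_radialMeasure :
    (volume : Measure ℝ).restrict (Ioo 0 1) ≪ radialMeasure := by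
  refine (Measure.restrict_mono Ioo_subset_Ioi_self le_rfl).absolutelyContinuous.trans ?_
  refine withDensity_absolutelyContinuous' (by fun_prop) ?_
  filter_upwards [ae_restrict_mem measurableSet_Ioi] with r hr
  simp only [ne_eq, ENNReal.ofReal_eq_zero, not_le]
  have := mem_Ioi.1 hr
  positivity

/-- A property that holds almost everywhere in the ball holds, on some sphere, for almost all
latitudes and longitudes. -/
lemma exists_radius_ae {Q : E3 → Prop} (h : ∀ᵐ x ∂(volume.restrict B1), Q x) :
    ∃ r : ℝ, 0 < r ∧
      ∀ᵐ s ∂(latMeasure.prod (volume.restrict (Ioo (-Real.pi) Real.pi))), Q (mercator (r, s)) := by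
  have hB : MeasurableSet B1 := measurableSet_ball
  rw [ae_restrict_iff' hB, ← measurePreserving_mercator.map_eq] at h
  have h1 := ae_of_ae_map measurePreserving_mercator.measurable.aemeasurable h
  have h2 : ∀ᵐ r ∂((volume : Measure ℝ).restrict (Ioo 0 1)), _ :=
    volume_restrict_ac_radialMeasure.ae_le (Measure.ae_ae_of_ae_prod h1)
  have h3 : ∀ᵐ r ∂((volume : Measure ℝ).restrict (Ioo 0 1)), r ∈ Ioo (0 : ℝ) 1 :=
    ae_restrict_mem measurableSet_Ioo
  have : Filter.NeBot (ae ((volume : Measure ℝ).restrict (Ioo 0 1))) := by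
    rw [ae_neBot]; intro h0
    rw [Measure.restrict_eq_zero] at h0
    simp at h0
  obtain ⟨r, hr, hr'⟩ := (h2.and h3).exists
  refine ⟨r, hr'.1, ?_⟩
  filter_upwards [hr] with s hs
  refine hs ?_
  rw [B1, mem_ball_zero_iff, (mercator_spec (p := (r, s)) hr'.1).2.2]
  exact hr'.2

lemma restrict_Ioo_pi_ne_zero : (volume : Measure ℝ).restrict (Ioo (-Real.pi) Real.pi) ≠ 0 := by
  intro h
  rw [Measure.restrict_eq_zero] at h
  simp at h
  exact absurd h Real.pi_pos.not_ge

instance : Filter.NeBot (ae ((volume : Measure ℝ).restrict (Ioo (-Real.pi) Real.pi))) :=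
  ae_neBot.2 restrict_Ioo_pi_ne_zero

/-- Fubini on one good sphere: almost every latitude has some admissible azimuth, and the density
`cosh⁻²` is positive. -/
lemma ae_lat_of_ae_ball {P : ℝ → Prop}
    (h : ∀ᵐ x ∂(volume.restrict B1), 0 < rhoSq x → P (lat x)) : ∀ᵐ t, P t := by
  obtain ⟨r, hr, h1⟩ := exists_radius_ae h
  refine volume_ac_latMeasure.ae_le ?_
  filter_upwards [Measure.ae_ae_of_ae_prod h1] with t ht
  obtain ⟨θ, hθ⟩ := ht.exists
  have := mercator_spec (p := (r, t, θ)) hr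
  rw [this.2.1] at hθ
  exact hθ this.1

/-- No measurability of `v` is assumed; the profile is recovered from a measurable version of the
map on one sphere by pairing with the angular factors, and the azimuth is then dropped. -/
lemma aestronglyMeasurable_latProfile {v : ℝ → EuclideanSpace ℝ (Fin 3)}
    (h : AEStronglyMeasurable (augmentPolar v) (volume.restrict B1)) (k : Fin 3) :
    AEStronglyMeasurable (latProfile v k) := by
  obtain ⟨w, hw, hvw⟩ := h
  obtain ⟨r, hr, h1⟩ := exists_radius_ae hvw
  have hF : Measurable fun x : E3 =>
      ∑ j, (if profileIndex j = k then w x j * angular j x else 0) := by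
    refine Finset.measurable_sum _ fun j _ => ?_
    split_ifs
    · have hρ : Measurable rho := continuous_rho.measurable
      have ha : Measurable (angular j) := by
        fin_cases j <;> simp [angular] <;> fun_prop
      have hwj : Measurable fun x => w x j :=
        (EuclideanSpace.proj (𝕜 := ℝ) j).continuous.measurable.comp hw.measurable
      exact hwj.mul ha
    · exact measurable_const
  have hm : Measurable fun s : ℝ × ℝ => mercator (r, s) :=
    measurePreserving_mercator.measurable.comp (by fun_prop)
  have h2 : AEStronglyMeasurable (fun s : ℝ × ℝ => latProfile v k s.1)
      (latMeasure.prod (volume.restrict (Ioo (-Real.pi) Real.pi))) := by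
    refine ((hF.comp hm).aestronglyMeasurable).congr ?_
    filter_upwards [h1] with s hs
    have hx := mercator_spec (p := (r, s)) hr
    have e := sum_angular_sq k hx.1
    calc ∑ j, (if profileIndex j = k then w (mercator (r, s)) j * angular j (mercator (r, s)) else 0)
        = ∑ j, latProfile v k s.1 *
            (if profileIndex j = k then angular j (mercator (r, s)) ^ 2 else 0) := by
          refine Finset.sum_congr rfl fun j _ => ?_
          split_ifs with hj
          · rw [← hs, augmentPolar_eq v j hx.1, hj, hx.2.1]; ring
          · simp
      _ = latProfile v k s.1 := by rw [← Finset.mul_sum, e, mul_one]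
  exact (h2.of_comp_fst restrict_Ioo_pi_ne_zero).mono_ac volume_ac_latMeasure

lemma augmentPolar_normSq (v : ℝ → EuclideanSpace ℝ (Fin 3)) {x : E3} (hx : 0 < rhoSq x) :
    ‖augmentPolar v x‖ ^ 2 = ∑ k, latProfile v k (lat x) ^ 2 := by
  have h0 := sum_angular_sq 0 hx
  have h1 := sum_angular_sq 1 hx
  have h2 := sum_angular_sq 2 hx
  rw [EuclideanSpace.norm_sq_eq]
  simp only [augmentPolar_eq v _ hx, Real.norm_eq_abs, sq_abs]
  simp [Fin.sum_univ_five, Fin.sum_univ_three, profileIndex] at h0 h1 h2 ⊢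
  rcases h1 with h1 | h1 <;>
  simp only [mul_pow, h1] <;>
  linear_combination latProfile v 0 (lat x) ^ 2 * h0 + latProfile v 2 (lat x) ^ 2 * h2

lemma ae_sum_sq_latProfile {v : ℝ → EuclideanSpace ℝ (Fin 3)}
    (h : ∀ᵐ x ∂(volume.restrict B1), ‖augmentPolar v x‖ = 1) :
    ∀ᵐ t, ∑ k, latProfile v k t ^ 2 = 1 := by
  refine ae_lat_of_ae_ball ?_
  filter_upwards [h] with x hx hq
  rw [← augmentPolar_normSq v hq, hx, one_pow]

lemma integrable_radialMeasure {A : ℝ → ℝ} (h : Integrable fun r => r ^ 2 * A r) :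
    Integrable A radialMeasure := by
  rw [radialMeasure, integrable_withDensity_iff_integrable_smul' (by fun_prop) (by simp)]
  refine h.integrableOn.congr_fun_ae (Filter.Eventually.of_forall fun r => ?_)
  simp only [smul_eq_mul]
  rw [ENNReal.toReal_ofReal (by positivity)]

lemma integral_radialMeasure (A : ℝ → ℝ) :
    ∫ r, A r ∂radialMeasure = ∫ r in Ioi 0, r ^ 2 * A r := by
  rw [radialMeasure, integral_withDensity_eq_integral_toReal_smul (by fun_prop) (by simp)]
  refine integral_congr_ae (Filter.Eventually.of_forall fun r => ?_)
  simp only [smul_eq_mul]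
  rw [ENNReal.toReal_ofReal (by positivity)]

lemma integrable_latMeasure {B : ℝ → ℝ} (h : Integrable fun t => (Real.cosh t ^ 2)⁻¹ * B t) :
    Integrable B latMeasure := by
  rw [latMeasure, integrable_withDensity_iff_integrable_smul' (by fun_prop) (by simp)]
  refine h.congr (Filter.Eventually.of_forall fun r => ?_)
  simp only [smul_eq_mul]
  rw [ENNReal.toReal_ofReal (by positivity)]

lemma integral_latMeasure (B : ℝ → ℝ) :
    ∫ t, B t ∂latMeasure = ∫ t, (Real.cosh t ^ 2)⁻¹ * B t := by
  rw [latMeasure, integral_withDensity_eq_integral_toReal_smul (by fun_prop) (by simp)]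
  refine integral_congr_ae (Filter.Eventually.of_forall fun r => ?_)
  simp only [smul_eq_mul]
  rw [ENNReal.toReal_ofReal (by positivity)]

/-- Integration of separated functions. -/
lemma integral_norm_lat {A B : ℝ → ℝ} (hA : Measurable A) (hB : AEStronglyMeasurable B)
    (hAi : Integrable fun r => r ^ 2 * A r)
    (hBi : Integrable fun t => (Real.cosh t ^ 2)⁻¹ * B t) :
    Integrable (fun x : E3 => A ‖x‖ * B (lat x)) ∧
    ∫ x : E3, A ‖x‖ * B (lat x) =
      2 * Real.pi * ((∫ r in Ioi 0, r ^ 2 * A r) * ∫ t, (Real.cosh t ^ 2)⁻¹ * B t) := by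
  have hmeas : AEStronglyMeasurable (fun x : E3 => A ‖x‖ * B (lat x)) :=
    (hA.comp measurable_norm).aestronglyMeasurable.mul
      (hB.comp_quasiMeasurePreserving quasiMeasurePreserving_lat)
  have hcongr : (fun p : ℝ × ℝ × ℝ => A p.1 * (B p.2.1 * 1)) =ᵐ[mercatorMeasure]
      (fun x : E3 => A ‖x‖ * B (lat x)) ∘ mercator := by
    filter_upwards [ae_pos_mercatorMeasure] with p hp
    simp only [Function.comp, (mercator_spec hp).2.1, (mercator_spec hp).2.2, mul_one]
  have hint : Integrable (fun p : ℝ × ℝ × ℝ => A p.1 * (B p.2.1 * 1)) mercatorMeasure :=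
    (integrable_radialMeasure hAi).mul_prod
      ((integrable_latMeasure hBi).mul_prod
        (integrable_const (1 : ℝ) (μ := volume.restrict (Ioo (-Real.pi) Real.pi))))
  refine ⟨(measurePreserving_mercator.integrable_comp hmeas).1 (hint.congr hcongr), ?_⟩
  have e1 : ∫ x : E3, A ‖x‖ * B (lat x) =
      ∫ p, ((fun x : E3 => A ‖x‖ * B (lat x)) ∘ mercator) p ∂mercatorMeasure := by
    have := integral_map (μ := mercatorMeasure) measurePreserving_mercator.measurable.aemeasurable
      (f := fun x : E3 => A ‖x‖ * B (lat x)) (by rwa [measurePreserving_mercator.map_eq])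
    rw [measurePreserving_mercator.map_eq] at this
    exact this
  rw [e1, ← integral_congr_ae hcongr, mercatorMeasure, integral_prod_mul A (fun s : ℝ × ℝ => B s.1 * 1),
    integral_prod_mul B (fun _ => (1 : ℝ)), integral_radialMeasure, integral_latMeasure]
  simp [Real.volume_real_Ioo, Real.pi_pos.le]
  ring

/-! ### The equation of the profile -/

lemma exists_radial_cutoff : ∃ χ : ℝ → ℝ, IsTest χ ∧ tsupport χ ⊆ Ioo 0 1 ∧ (∀ r, 0 ≤ χ r) ∧
    0 < ∫ r in Ioi 0, χ (r ^ 2) := by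
  let b : ContDiffBump (1 / 2 : ℝ) := ⟨1 / 8, 1 / 4, by norm_num, by norm_num⟩
  have hb : IsTest b := ⟨b.contDiff, b.hasCompactSupport⟩
  have hts : tsupport b ⊆ Ioo (0 : ℝ) 1 := by
    rw [b.tsupport_eq, Real.closedBall_eq_Icc]
    intro x hx
    simp only [b, mem_Icc] at hx
    constructor <;> linarith [hx.1, hx.2]
  refine ⟨b, hb, hts, fun _ => b.nonneg, ?_⟩
  have hc : Continuous fun r : ℝ => b (r ^ 2) := hb.continuous.comp (by fun_prop)
  have hcs : HasCompactSupport fun r : ℝ => b (r ^ 2) :=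
    HasCompactSupport.intro (isCompact_Icc (a := (-1 : ℝ)) (b := 1)) fun r hr => by
      refine image_eq_zero_of_notMem_tsupport fun h => hr ?_
      have := hts h
      exact ⟨by nlinarith [this.2], by nlinarith [this.2]⟩
  rw [setIntegral_pos_iff_support_of_nonneg_ae (Filter.Eventually.of_forall fun r => b.nonneg)
    (hc.integrable_of_hasCompactSupport hcs).integrableOn]
  refine (hc.isOpen_support.inter isOpen_Ioi).measure_pos _ ⟨√(1 / 2), ?_, by simp⟩
  rw [Function.mem_support, Real.sq_sqrt (by norm_num)]
  exact (b.pos_of_mem_ball (by simp [b])).ne'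

lemma IsTest.comp_sq {χ : ℝ → ℝ} (h : IsTest χ) (hs : tsupport χ ⊆ Ioo 0 1) :
    IsTest fun r => χ (r ^ 2) :=
  ⟨h.1.comp (by fun_prop), HasCompactSupport.intro (isCompact_Icc (a := (-1 : ℝ)) (b := 1))
    fun r hr => by
      refine image_eq_zero_of_notMem_tsupport fun h => hr ?_
      have := hs h
      exact ⟨by nlinarith [this.2], by nlinarith [this.2]⟩⟩

lemma IsTest.smooth_mul {f χ : ℝ → ℝ} (hf : ContDiff ℝ ∞ f) (h : IsTest χ) :
    IsTest fun r => f r * χ r := ⟨hf.mul h.1, h.2.mul_left⟩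

lemma IsTest.integrable {χ : ℝ → ℝ} (h : IsTest χ) : Integrable χ :=
  h.continuous.integrable_of_hasCompactSupport h.2

/-- The radial part of the Laplacian has zero mean. -/
lemma integral_radial_laplacian {χ : ℝ → ℝ} (h : IsTest χ) (hs : tsupport χ ⊆ Ioo 0 1) :
    Integrable (fun r => r ^ 2 * (4 * r ^ 2 * deriv (deriv χ) (r ^ 2) + 6 * deriv χ (r ^ 2))) ∧
    ∫ r in Ioi 0, r ^ 2 * (4 * r ^ 2 * deriv (deriv χ) (r ^ 2) + 6 * deriv χ (r ^ 2)) = 0 := by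
  have hs' : tsupport (deriv χ) ⊆ Ioo 0 1 := (tsupport_deriv_subset (𝕜 := ℝ)).trans hs
  have hP : IsTest fun r => 2 * r ^ 3 * deriv χ (r ^ 2) :=
    (h.differentiate.comp_sq hs').smooth_mul (by fun_prop)
  -- This is `(r² f')'` for `f r = χ (r²)`, the divergence form of the radial Laplacian.
  have hd : deriv (fun r => 2 * r ^ 3 * deriv χ (r ^ 2)) =
      fun r => r ^ 2 * (4 * r ^ 2 * deriv (deriv χ) (r ^ 2) + 6 * deriv χ (r ^ 2)) := by
    funext r
    have h1 := (((hasDerivAt_id r).pow 3).const_mul 2).mul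
      ((h.differentiate.hasDerivAt (r ^ 2)).comp r ((hasDerivAt_id r).pow 2))
    refine (h1.congr_deriv ?_).deriv
    simp only [Function.comp, id, Pi.pow_apply]
    norm_num
    ring
  rw [← hd]
  refine ⟨hP.differentiate.integrable, ?_⟩
  rw [HasCompactSupport.integral_Ioi_deriv_eq (hP.1.of_le (by simp)) hP.2]
  simp

/-- The pushforward of an integrable weight in the ball to the latitude. -/
lemma exists_lat_density {e : E3 → ℝ} (he : ∀ x, 0 ≤ e x) (hi : IntegrableOn e B1) :
    ∃ g : ℝ → ℝ, Integrable g ∧ ∀ f : ℝ → ℝ, AEStronglyMeasurable f →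
      ∫ x in B1, e x * f (lat x) = ∫ t, g t * f t := by
  have hae : AEMeasurable (fun x => ENNReal.ofReal (e x)) (volume.restrict B1) :=
    hi.aestronglyMeasurable.aemeasurable.ennreal_ofReal
  set m := (volume.restrict B1).withDensity fun x => ENNReal.ofReal (e x) with hm
  have hfin : IsFiniteMeasure m := isFiniteMeasure_withDensity_ofReal hi.2
  have hmac : m ≪ volume :=
    (withDensity_absolutelyContinuous _ _).trans Measure.restrict_le_self.absolutelyContinuous
  set ν := m.map lat with hν
  have hνac : ν ≪ volume :=
    (hmac.map measurable_lat).trans quasiMeasurePreserving_lat.absolutelyContinuous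
  have hνfin : IsFiniteMeasure ν := inferInstance
  refine ⟨fun t => (ν.rnDeriv volume t).toReal, Measure.integrable_toReal_rnDeriv, fun f hf => ?_⟩
  -- The density is the Radon-Nikodym derivative of the pushforward, so no structure of `e` beyond
  -- sign and integrability is used.
  have h1 := integral_rnDeriv_smul hνac (f := f)
  simp only [smul_eq_mul] at h1
  rw [h1, hν, integral_map measurable_lat.aemeasurable (hf.mono_ac hνac), hm,
    integral_withDensity_eq_integral_toReal_smul₀ hae (by simp)]
  refine integral_congr_ae (Filter.Eventually.of_forall fun x => ?_)
  simp only [smul_eq_mul]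
  rw [ENNReal.toReal_ofReal (he x)]

/-- The profile of a harmonic map solves a weak second order system in the latitude. -/
theorem exists_weak_system {v : ℝ → EuclideanSpace ℝ (Fin 3)}
    (h : IsHarmonicMap B1 (augmentPolar v)) :
    (∀ k, AEStronglyMeasurable (latProfile v k)) ∧ (∀ᵐ t, ∑ k, latProfile v k t ^ 2 = 1) ∧
    ∃ g : ℝ → ℝ, Integrable g ∧ ∀ k, ∀ η, IsTest η →
      ∫ t, latProfile v k t * (deriv (deriv η) t - potential k * η t) =
        -∫ t, g t * (latProfile v k t * η t) := by
  obtain ⟨e, he, hei, heq⟩ := h.exists_multiplier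
  obtain ⟨-, hw, -, -, hw1, -⟩ := h
  have hU := aestronglyMeasurable_latProfile hw.aestronglyMeasurable
  have hUs := ae_sum_sq_latProfile hw1
  refine ⟨hU, hUs, ?_⟩
  have hUb : ∀ k, ∀ᵐ t, ‖latProfile v k t‖ ≤ 1 := fun k => by
    filter_upwards [hUs] with t ht
    rw [Real.norm_eq_abs, ← sq_le_one_iff_abs_le_one, ← ht]
    exact Finset.single_le_sum (f := fun k => latProfile v k t ^ 2) (fun i _ => sq_nonneg _)
      (Finset.mem_univ k)
  have hUloc : ∀ k, LocallyIntegrable (latProfile v k) := fun k =>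
    (memLp_top_of_bound (hU k) 1 (hUb k)).locallyIntegrable le_top
  obtain ⟨χ, hχ, hχs, hχ0, hχpos⟩ := exists_radial_cutoff
  have hC2 : ∀ {η : ℝ → ℝ}, IsTest η → ContDiff ℝ 2 η := fun h => by exact_mod_cast contDiff_infty.1 h.1 2
  obtain ⟨C, hC⟩ := hχ.2.exists_bound_of_continuous hχ.continuous
  have hχn : AEStronglyMeasurable (fun x : E3 => χ (‖x‖ ^ 2)) (volume.restrict B1) :=
    (hχ.continuous.comp (by fun_prop)).aestronglyMeasurable
  have heχ : IntegrableOn (fun x => χ (‖x‖ ^ 2) * e x) B1 :=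
    hei.bdd_mul hχn (Filter.Eventually.of_forall fun x => hC _)
  obtain ⟨g, hg, hgeq⟩ := exists_lat_density (fun x => mul_nonneg (hχ0 _) (he x)) heχ
  -- The factor left by integrating out azimuth and radius; the weight `r²` of the volume cancels
  -- the `1 / r²` in `1 / ρ²`.
  set c := 2 * Real.pi * ∫ r in Ioi 0, χ (r ^ 2) with hc
  have hcpos : 0 < c := by have := Real.pi_pos; positivity
  refine ⟨fun t => c⁻¹ * g t, hg.const_mul _, fun k η hη => ?_⟩
  set a : ℝ → ℝ := fun t => deriv (deriv η) t - potential k * η t with ha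
  have hat : IsTest a := hη.differentiate.differentiate.sub_smul hη _
  have hψ := fun j => separated_isTestFunction hχ hχs hη j
  have hsum : ∑ j, (if profileIndex j = k then
      ∫ x in B1, augmentPolar v x j * lap (separated χ η j) x else 0) =
      ∑ j, (if profileIndex j = k then
        -∫ x in B1, e x * (augmentPolar v x j * separated χ η j x) else 0) :=
    Finset.sum_congr rfl fun j _ => by rw [heq j _ (hψ j)]
  have hwj : ∀ j, MemLp (fun x => augmentPolar v x j) 2 (volume.restrict B1) := fun j =>
    (EuclideanSpace.proj (𝕜 := ℝ) j).comp_memLp' hw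
  have hrho : ∀ᵐ x ∂(volume.restrict B1), 0 < rhoSq x := ae_restrict_of_ae ae_rhoSq_pos
  -- The left-hand side reduces to the latitude.
  have hL : ∑ j, (if profileIndex j = k then
      ∫ x in B1, augmentPolar v x j * lap (separated χ η j) x else 0) =
      c * ∫ t, latProfile v k t * a t := by
    have hint : ∀ j, IntegrableOn (fun x => augmentPolar v x j * lap (separated χ η j) x) B1 :=
      fun j => MemLp.integrable_mul (p := 2) (q := 2) (hwj j)
        ((hψ j).lap.1.memLp_of_hasCompactSupport (hψ j).lap.2)
    set A1 : ℝ → ℝ := fun r => χ (r ^ 2) * (r ^ 2)⁻¹ with hA1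
    set A2 : ℝ → ℝ := fun r => 4 * r ^ 2 * deriv (deriv χ) (r ^ 2) + 6 * deriv χ (r ^ 2) with hA2
    set D1 : ℝ → ℝ := fun t => latProfile v k t * (a t * Real.cosh t ^ 2) with hD1
    set D2 : ℝ → ℝ := fun t => latProfile v k t * η t with hD2
    have hs' : tsupport (deriv χ) ⊆ Ioo 0 1 := (tsupport_deriv_subset (𝕜 := ℝ)).trans hχs
    have hs'' : tsupport (deriv (deriv χ)) ⊆ Ioo 0 1 := (tsupport_deriv_subset (𝕜 := ℝ)).trans hs'
    -- At `r = 0` the cancellation fails, but there `χ` vanishes.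
    have r1 : (fun r => r ^ 2 * A1 r) = fun r => χ (r ^ 2) := by
      funext r
      by_cases hr : r = 0
      · subst hr
        have : χ 0 = 0 := image_eq_zero_of_notMem_tsupport fun h0 => lt_irrefl _ (hχs h0).1
        simp [this]
      · simp only [hA1]; field_simp
    have r2 : (fun t => (Real.cosh t ^ 2)⁻¹ * D1 t) = fun t => latProfile v k t * a t := by
      funext t
      have := (Real.cosh_pos t).ne'
      simp only [hD1]; field_simp
    have m1 : Measurable A1 :=
      ((hχ.comp_sq hχs).continuous.measurable).mul (by fun_prop)
    have m2 : Measurable A2 := by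
      have c1 := (hχ.differentiate.comp_sq hs').continuous
      have c2 := (hχ.differentiate.differentiate.comp_sq hs'').continuous
      exact (((continuous_const.mul (continuous_pow 2)).mul c2).add (continuous_const.mul c1)).measurable
    have I1 := integral_norm_lat m1 (B := D1)
      ((hU k).mul (hat.continuous.mul (by fun_prop)).aestronglyMeasurable)
      (by rw [r1]; exact (hχ.comp_sq hχs).integrable)
      (by rw [r2]; exact hat.integrable_mul (hUloc k))
    have I2 := integral_norm_lat m2 (B := D2) ((hU k).mul hη.continuous.aestronglyMeasurable)
      (integral_radial_laplacian hχ hχs).1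
      (by
        have hci : ContDiff ℝ ∞ fun t => (Real.cosh t ^ 2)⁻¹ :=
          (Real.contDiff_cosh.pow 2).inv fun t => by have := Real.cosh_pos t; positivity
        refine ((hη.smooth_mul hci).integrable_mul (hUloc k)).congr
          (Filter.Eventually.of_forall fun t => ?_)
        simp only [hD2]; ring)
    have hzero : ∀ x : E3, x ∉ B1 → A1 ‖x‖ * D1 (lat x) + A2 ‖x‖ * D2 (lat x) = 0 := by
      intro x hx
      have hx1 : 1 ≤ ‖x‖ ^ 2 := by
        rw [B1, mem_ball_zero_iff, not_lt] at hx
        nlinarith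
      have z0 : χ (‖x‖ ^ 2) = 0 := image_eq_zero_of_notMem_tsupport fun h => (hχs h).2.not_ge hx1
      have z1 : deriv χ (‖x‖ ^ 2) = 0 :=
        image_eq_zero_of_notMem_tsupport fun h => (hs' h).2.not_ge hx1
      have z2 : deriv (deriv χ) (‖x‖ ^ 2) = 0 :=
        image_eq_zero_of_notMem_tsupport fun h => (hs'' h).2.not_ge hx1
      simp only [hA1, hA2, z0, z1, z2]; ring
    have e1 : ∑ j, (if profileIndex j = k then
        ∫ x in B1, augmentPolar v x j * lap (separated χ η j) x else 0) =
        ∫ x in B1, ∑ j, (if profileIndex j = k then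
          augmentPolar v x j * lap (separated χ η j) x else 0) := by
      rw [integral_finsetSum]
      · refine Finset.sum_congr rfl fun j _ => ?_
        split_ifs <;> simp
      · intro j _
        split_ifs
        · exact hint j
        · exact integrable_zero _ _ _
    have e2 : ∫ x in B1, ∑ j, (if profileIndex j = k then
          augmentPolar v x j * lap (separated χ η j) x else 0) =
        ∫ x in B1, (A1 ‖x‖ * D1 (lat x) + A2 ‖x‖ * D2 (lat x)) := by
      refine integral_congr_ae ?_
      filter_upwards [hrho] with x hx
      have e3 : ∀ j, (if profileIndex j = k then
          augmentPolar v x j * lap (separated χ η j) x else 0) =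
          (A1 ‖x‖ * D1 (lat x) + A2 ‖x‖ * D2 (lat x)) *
            (if profileIndex j = k then angular j x ^ 2 else 0) := fun j => by
        split_ifs with hj
        · rw [augmentPolar_eq v j hx, (lap_separated (hC2 hχ) (hC2 hη) j hx).2, hj,
            rhoSq_eq_norm_div_cosh hx]
          have hn := norm_pos_of_rhoSq hx
          have hch := Real.cosh_pos (lat x)
          simp only [hA1, hA2, hD1, hD2, ha]
          field_simp
        · simp
      simp only [e3]
      rw [← Finset.mul_sum, sum_angular_sq k hx, mul_one]
    rw [e1, e2, setIntegral_eq_integral_of_forall_compl_eq_zero hzero,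
      integral_add I1.1 I2.1, I1.2, I2.2, (integral_radial_laplacian hχ hχs).2, r1, r2, hc]
    ring
  -- The right-hand side reduces to the latitude.
  have hR : ∑ j, (if profileIndex j = k then
        -∫ x in B1, e x * (augmentPolar v x j * separated χ η j x) else 0) =
      -∫ t, g t * (latProfile v k t * η t) := by
    rw [← hgeq (fun t => latProfile v k t * η t) ((hU k).mul hη.continuous.aestronglyMeasurable)]
    have hint : ∀ j, IntegrableOn (fun x => e x * (augmentPolar v x j * separated χ η j x)) B1 := by
      intro j
      obtain ⟨C', hC'⟩ := (hψ j).2.1.exists_bound_of_continuous (hψ j).continuous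
      have h1 : IntegrableOn (fun x => (augmentPolar v x j * separated χ η j x) * e x) B1 := by
        refine hei.bdd_mul (c := C') ((hwj j).aestronglyMeasurable.mul
          (hψ j).continuous.aestronglyMeasurable) ?_
        filter_upwards [hw1] with x hx
        rw [norm_mul]
        calc ‖augmentPolar v x j‖ * ‖separated χ η j x‖ ≤ 1 * C' :=
            mul_le_mul ((PiLp.norm_apply_le _ j).trans hx.le) (hC' x) (norm_nonneg _) zero_le_one
          _ = C' := one_mul _
      exact h1.congr (Filter.Eventually.of_forall fun x => mul_comm _ _)
    have e1 : ∑ j, (if profileIndex j = k then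
        -∫ x in B1, e x * (augmentPolar v x j * separated χ η j x) else 0) =
        -∫ x in B1, ∑ j, (if profileIndex j = k then
          e x * (augmentPolar v x j * separated χ η j x) else 0) := by
      rw [integral_finsetSum, ← Finset.sum_neg_distrib]
      · refine Finset.sum_congr rfl fun j _ => ?_
        split_ifs <;> simp
      · intro j _
        split_ifs
        · exact hint j
        · exact integrable_zero _ _ _
    rw [e1]
    congr 1
    refine integral_congr_ae ?_
    filter_upwards [hrho] with x hx
    have e3 : ∀ j, (if profileIndex j = k then
        e x * (augmentPolar v x j * separated χ η j x) else 0) =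
        (χ (‖x‖ ^ 2) * e x * (latProfile v k (lat x) * η (lat x))) *
          (if profileIndex j = k then angular j x ^ 2 else 0) := fun j => by
      split_ifs with hj
      · rw [augmentPolar_eq v j hx, hj, separated]; ring
      · simp
    simp only [e3]
    rw [← Finset.mul_sum, sum_angular_sq k hx, mul_one]
  rw [hL, hR] at hsum
  have e4 : ∫ t, c⁻¹ * g t * (latProfile v k t * η t) =
      c⁻¹ * ∫ t, g t * (latProfile v k t * η t) := by
    rw [← integral_const_mul]
    simp only [mul_assoc]
  rw [e4, ← mul_neg, ← hsum, inv_mul_cancel_left₀ hcpos.ne']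

/-! ### Return to the polar angle -/

/-- The polar angle as a function of the latitude. -/
def latAngle (t : ℝ) : ℝ := Real.arccos (Real.tanh t)

/-- The latitude as a function of the polar angle. -/
def angleLat (φ : ℝ) : ℝ := Real.arsinh (Real.cos φ / Real.sin φ)

lemma tanh_mem (t : ℝ) : -1 < Real.tanh t ∧ Real.tanh t < 1 := abs_lt.1 (Real.abs_tanh_lt_one t)

lemma cos_latAngle (t : ℝ) : Real.cos (latAngle t) = Real.tanh t :=
  Real.cos_arccos (tanh_mem t).1.le (tanh_mem t).2.le

lemma sin_latAngle (t : ℝ) : Real.sin (latAngle t) = (Real.cosh t)⁻¹ := by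
  have hc := Real.cosh_pos t
  rw [latAngle, Real.sin_arccos, Real.tanh_eq_sinh_div_cosh,
    show 1 - (Real.sinh t / Real.cosh t) ^ 2 = ((Real.cosh t)⁻¹) ^ 2 by
      have := Real.cosh_sq t
      field_simp
      linarith]
  exact Real.sqrt_sq (by positivity)

lemma latAngle_mem (t : ℝ) : latAngle t ∈ Ioo 0 Real.pi := by
  have h := cos_latAngle t
  refine ⟨Real.arccos_pos.2 (tanh_mem t).2, lt_of_le_of_ne (Real.arccos_le_pi _) fun h' => ?_⟩
  rw [show latAngle t = Real.pi from h', Real.cos_pi] at h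
  linarith [(tanh_mem t).1]

lemma angleLat_latAngle (t : ℝ) : angleLat (latAngle t) = t := by
  have hc := (Real.cosh_pos t).ne'
  rw [angleLat, cos_latAngle, sin_latAngle, Real.tanh_eq_sinh_div_cosh, div_div,
    mul_inv_cancel₀ hc, div_one, Real.arsinh_sinh]

lemma latAngle_angleLat {φ : ℝ} (h : φ ∈ Ioo 0 Real.pi) : latAngle (angleLat φ) = φ := by
  have hs := Real.sin_pos_of_mem_Ioo h
  have e : Real.tanh (angleLat φ) = Real.cos φ := by
    rw [angleLat, Real.tanh_eq_sinh_div_cosh, Real.sinh_arsinh, Real.cosh_arsinh,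
      show 1 + (Real.cos φ / Real.sin φ) ^ 2 = ((Real.sin φ)⁻¹) ^ 2 by
        have := Real.sin_sq_add_cos_sq φ
        field_simp
        linarith, Real.sqrt_sq (by positivity)]
    field_simp
  rw [latAngle, e, Real.arccos_cos h.1.le h.2.le]

lemma differentiable_latAngle : Differentiable ℝ latAngle := fun t =>
  (Real.differentiableAt_arccos.2 ⟨(tanh_mem t).1.ne', (tanh_mem t).2.ne⟩).comp t
    (hasDerivAt_tanh t).differentiableAt

lemma differentiableOn_angleLat : DifferentiableOn ℝ angleLat (Ioo 0 Real.pi) := fun φ h =>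
  (Real.differentiable_arsinh.differentiableAt.comp φ
    (Real.differentiableAt_cos.div Real.differentiableAt_sin
      (Real.sin_pos_of_mem_Ioo h).ne')).differentiableWithinAt

/-- Both the polar angle as a function of latitude and its inverse are differentiable, hence carry
null sets to null sets. -/
lemma ae_latAngle_iff {P : ℝ → Prop} :
    (∀ᵐ t, P (latAngle t)) ↔ ∀ᵐ φ ∂((volume : Measure ℝ).restrict (Ioo 0 Real.pi)), P φ := by
  rw [ae_restrict_iff' measurableSet_Ioo, ae_iff, ae_iff]
  constructor <;> intro h
  · refine measure_mono_null (t := latAngle '' {t | ¬P (latAngle t)}) (fun φ hφ => ?_)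
      (addHaar_image_eq_zero_of_differentiableOn_of_addHaar_eq_zero _
        differentiable_latAngle.differentiableOn h)
    simp only [mem_ofPred_eq, Classical.not_imp] at hφ
    exact ⟨angleLat φ, by simpa only [mem_ofPred_eq, latAngle_angleLat hφ.1] using hφ.2,
      latAngle_angleLat hφ.1⟩
  · refine measure_mono_null (t := angleLat '' {φ | ¬(φ ∈ Ioo 0 Real.pi → P φ)}) (fun t ht => ?_)
      (addHaar_image_eq_zero_of_differentiableOn_of_addHaar_eq_zero _
        (differentiableOn_angleLat.mono fun φ hφ => ?_) h)
    · exact ⟨latAngle t, fun h' => ht (h' (latAngle_mem t)), angleLat_latAngle t⟩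
    · simp only [mem_ofPred_eq, Classical.not_imp] at hφ
      exact hφ.1

lemma agreesOn_of_ae_latAngle {v u : ℝ → EuclideanSpace ℝ (Fin 3)}
    (hu : ContinuousOn u (Icc 0 Real.pi)) (h : ∀ᵐ t, v (latAngle t) = u (latAngle t)) :
    AgreesOn v u := by
  have h1 : ∀ᵐ φ ∂((volume : Measure ℝ).restrict (Icc 0 Real.pi)), v φ = u φ := by
    rw [← Measure.restrict_congr_set Ioo_ae_eq_Icc]
    exact ae_latAngle_iff.1 h
  exact ⟨h1, fun hv => Measure.eqOn_Icc_of_ae_eq volume Real.pi_pos.ne h1 hv hu⟩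

lemma continuousOn_vec3 {f g h : ℝ → ℝ} {s : Set ℝ} (hf : ContinuousOn f s) (hg : ContinuousOn g s)
    (hh : ContinuousOn h s) :
    ContinuousOn (fun φ => (!₂[f φ, g φ, h φ] : EuclideanSpace ℝ (Fin 3))) s := by
  refine (PiLp.continuous_toLp 2 _).comp_continuousOn (continuousOn_pi.2 fun i => ?_)
  fin_cases i
  exacts [hf, hg, hh]

lemma abs_cos_lt_one {β : ℝ} (h : β ∈ Ioo 0 Real.pi) : |Real.cos β| < 1 := by
  rw [← sq_lt_one_iff_abs_lt_one]
  nlinarith [Real.sin_sq_add_cos_sq β, Real.sin_pos_of_mem_Ioo h]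

lemma one_add_cos_mul_pos {β : ℝ} (h : β ∈ Ioo 0 Real.pi) (ψ : ℝ) :
    0 < 1 + Real.cos β * Real.cos ψ ∧ 0 < 1 - Real.cos β * Real.cos ψ := by
  have h1 : |Real.cos β * Real.cos ψ| < 1 := by
    rw [abs_mul]
    exact mul_lt_one_of_nonneg_of_lt_one_left (abs_nonneg _) (abs_cos_lt_one h)
      (Real.abs_cos_le_one ψ)
  rw [abs_lt] at h1
  constructor <;> linarith

lemma continuous_J : Continuous J := by
  unfold J
  refine Real.continuous_arccos.comp (Continuous.div (by fun_prop) (by fun_prop) fun φ => ?_)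
  positivity

lemma continuous_classII {β : ℝ} (h : β ∈ Ioo 0 Real.pi) :
    Continuous (classIIa β) ∧ Continuous (classIIb β) := by
  constructor <;> rw [← continuousOn_univ] <;>
  refine continuousOn_vec3 continuousOn_const ?_ ?_ <;> rw [continuousOn_univ] <;>
  refine Continuous.div (by fun_prop) (by fun_prop) fun φ => ?_
  · exact (one_add_cos_mul_pos h φ).1.ne'
  · exact (one_add_cos_mul_pos h φ).1.ne'
  · exact (one_add_cos_mul_pos h φ).2.ne'
  · exact (one_add_cos_mul_pos h φ).2.ne'

lemma continuous_classIII {β : ℝ} (h : β ∈ Ioo 0 Real.pi) :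
    Continuous (classIIIa β) ∧ Continuous (classIIIb β) := by
  have hJ := continuous_J
  constructor <;> rw [← continuousOn_univ] <;>
  refine continuousOn_vec3 ?_ ?_ continuousOn_const <;> rw [continuousOn_univ] <;>
  refine Continuous.div (by fun_prop) (by fun_prop) fun φ => ?_
  · exact (one_add_cos_mul_pos h (J φ)).1.ne'
  · exact (one_add_cos_mul_pos h (J φ)).1.ne'
  · exact (one_add_cos_mul_pos h (J φ)).2.ne'
  · exact (one_add_cos_mul_pos h (J φ)).2.ne'

/-- The formula `tanh 2t = 2 tanh t / (1 + tanh² t)`: doubling the frequency is the substitution `φ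
↦ J φ`. -/
lemma J_latAngle (t : ℝ) : J (latAngle t) = latAngle (2 * t) := by
  rw [J, cos_latAngle, latAngle]
  congr 1
  have hc := (Real.cosh_pos t).ne'
  have h1 : Real.cosh t ^ 2 + Real.sinh t ^ 2 ≠ 0 := by
    have := Real.cosh_pos t; positivity
  rw [Real.tanh_eq_sinh_div_cosh, Real.tanh_eq_sinh_div_cosh, Real.sinh_two_mul, Real.cosh_two_mul]
  field_simp

lemma ext3 {a b : EuclideanSpace ℝ (Fin 3)} (h0 : a 0 = b 0) (h1 : a 1 = b 1) (h2 : a 2 = b 2) :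
    a = b := by
  ext i
  fin_cases i
  exacts [h0, h1, h2]

lemma augmentPolar_eq_smul_Nstar {v : ℝ → EuclideanSpace ℝ (Fin 3)} {x : E3} {s : ℝ}
    (hx : 0 < rhoSq x) (h0 : latProfile v 0 (lat x) = 0) (h1 : latProfile v 1 (lat x) = s)
    (h2 : latProfile v 2 (lat x) = 0) : augmentPolar v x = s • Nstar := by
  have hr := rho_pos hx
  have e : angular 2 x = 1 := by
    have h := rho_sq x
    rw [rhoSq] at h
    simp only [angular, Matrix.cons_val]
    field_simp
    exact h.symm
  ext j
  rw [augmentPolar_eq v j hx]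
  fin_cases j <;> simp [profileIndex, Nstar, h0, h1, h2, e]

lemma nonneg_of_ae_nonneg {f : ℝ → ℝ} (hf : Continuous f) (h : ∀ᵐ t, 0 ≤ f t) (t : ℝ) : 0 ≤ f t := by
  have hd : Dense {t | 0 ≤ f t} := Measure.dense_of_ae h
  have hc : IsClosed {t | 0 ≤ f t} := isClosed_le continuous_const hf
  have : t ∈ closure {t | 0 ≤ f t} := hd t
  rwa [hc.closure_eq] at this

end AxialHarmonic

end

/-! ### Transfer of the classification back to the polar angle. -/

theorem lemma4p3 (v : ℝ → EuclideanSpace ℝ (Fin 3))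
    (hharm : AxialHarmonic.IsHarmonicMap AxialHarmonic.B1 (AxialHarmonic.augmentPolar v))
    (hnonneg : ∀ᵐ φ ∂(volume.restrict (Ioo 0 Real.pi)), 0 ≤ v φ 0 ∧ 0 ≤ v φ 2) :
    ((∀ᵐ x ∂(volume.restrict AxialHarmonic.B1),
        AxialHarmonic.augmentPolar v x = AxialHarmonic.Nstar) ∨
      (∀ᵐ x ∂(volume.restrict AxialHarmonic.B1),
        AxialHarmonic.augmentPolar v x = -AxialHarmonic.Nstar)) ∨
    (∃ β₁ ∈ Ioo 0 Real.pi,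
      AxialHarmonic.AgreesOn v (AxialHarmonic.classIIa β₁) ∨
      AxialHarmonic.AgreesOn v (AxialHarmonic.classIIb β₁)) ∨
    (∃ β₂ ∈ Ioo 0 Real.pi,
      AxialHarmonic.AgreesOn v (AxialHarmonic.classIIIa β₂) ∨
      AxialHarmonic.AgreesOn v (AxialHarmonic.classIIIb β₂)) := by
  open AxialHarmonic in
  obtain ⟨hU, hUs, g, hg, hweak⟩ := exists_weak_system hharm
  obtain ⟨W, W', hUW, hsph, hW, hW', hE⟩ := exists_classical_solution hU hUs hg hweak
  have hnn : ∀ᵐ t, 0 ≤ v (latAngle t) 0 ∧ 0 ≤ v (latAngle t) 2 := ae_latAngle_iff.2 hnonneg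
  have hWc : ∀ k, Continuous (W k) := fun k =>
    continuous_iff_continuousAt.2 fun t => (hW k t).continuousAt
  have h0 : ∀ t, 0 ≤ W 0 t := nonneg_of_ae_nonneg (hWc 0) (by
    filter_upwards [hnn, hUW 0] with t h1 h2
    rw [← h2]; exact h1.1)
  have h2 : ∀ t, 0 ≤ W 2 t := nonneg_of_ae_nonneg (hWc 2) (by
    filter_upwards [hnn, hUW 2] with t h1 h2
    rw [← h2]; exact h1.2)
  have hconst : ∀ s : ℝ, (∀ t, W 0 t = 0 ∧ W 1 t = s ∧ W 2 t = 0) →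
      ∀ᵐ x ∂(volume.restrict B1), augmentPolar v x = s • Nstar := fun s hs => by
    refine ae_restrict_of_ae ?_
    filter_upwards [ae_rhoSq_pos, quasiMeasurePreserving_lat.ae (hUW 0),
      quasiMeasurePreserving_lat.ae (hUW 1), quasiMeasurePreserving_lat.ae (hUW 2)] with x hx e0 e1 e2
    exact augmentPolar_eq_smul_Nstar hx (e0.trans (hs _).1) (e1.trans (hs _).2.1)
      (e2.trans (hs _).2.2)
  have hae : ∀ u : ℝ → EuclideanSpace ℝ (Fin 3), Continuous u →
      (∀ t, W 0 t = u (latAngle t) 0 ∧ W 1 t = u (latAngle t) 1 ∧ W 2 t = u (latAngle t) 2) →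
      AgreesOn v u := fun u hu hs => by
    refine agreesOn_of_ae_latAngle hu.continuousOn ?_
    filter_upwards [hUW 0, hUW 1, hUW 2] with t e0 e1 e2
    exact ext3 (e0.trans (hs t).1) (e1.trans (hs t).2.1) (e2.trans (hs t).2.2)
  rcases classification hsph hW hW' hE h0 h2 with
    (h | h) | ⟨σ, hσ, β, hβ, h⟩ | ⟨σ, hσ, β, hβ, h⟩
  · left; left
    simpa using hconst 1 h
  · left; right
    simpa using hconst (-1) h
  · right; left
    refine ⟨β, hβ, ?_⟩
    -- With `tanh t = cos φ`, the sign `σ = 1` gives the second family and `σ = -1` the first.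
    rcases hσ with rfl | rfl
    · refine Or.inr (hae _ (continuous_classII hβ).2 fun t => ?_)
      rw [(h t).1, (h t).2.1, (h t).2.2]
      simp [classIIb, kink, soliton, cos_latAngle, sin_latAngle]
    · refine Or.inl (hae _ (continuous_classII hβ).1 fun t => ?_)
      rw [(h t).1, (h t).2.1, (h t).2.2]
      simp [classIIa, kink, soliton, cos_latAngle, sin_latAngle]
  · right; right
    refine ⟨β, hβ, ?_⟩
    rcases hσ with rfl | rfl
    · refine Or.inr (hae _ (continuous_classIII hβ).2 fun t => ?_)
      rw [(h t).1, (h t).2.1, (h t).2.2]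
      simp [classIIIb, kink, soliton, J_latAngle, cos_latAngle, sin_latAngle]
    · refine Or.inl (hae _ (continuous_classIII hβ).1 fun t => ?_)
      rw [(h t).1, (h t).2.1, (h t).2.2]
      simp [classIIIa, kink, soliton, J_latAngle, cos_latAngle, sin_latAngle]
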